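/- For complex $a$ and $0<q<1$ put $[a]_q=\frac{1-q^a}{1-q}$, $$(\alpha)!_q=(1-q)^{-\alpha}\prod_{n\ge1}\frac{1-q^n}{1-q^{\alpha+n}},\qquad \binom{\alpha}{\beta}_q=\frac{(\alpha)!_q}{(\alpha-\beta)!_q\,(\beta)!_q},\qquad \Gamma_q(x)=(x-1)!_q ,$$ where $1/(\alpha)!_q$ is taken to be $0$ at the poles of $(\alpha)!_q$, and at $q=1$ put $[a]_1=a$, $(\alpha)!_1=\Gamma(\alpha+1)$. For $0<q\le 1$ let $$(1+\mathrm{SinPi})(s,q^2)=q^{s^2-s}\prod_{n\ge0}\frac{[4n+3-2s]_q^2\,[4n+1+2s]_q^2}{[4n+3]_q^2\,[4n+1]_q^2},$$ so that the brackets may be replaced by $1-q^{4n+3-2s}$, etc., if $q<1$. For $0<q<1$ let $$C_2(q)=(1-q^4)^{-1/2}\prod_{n\ge0}\frac{1-q^{2n+1}}{1-q^{2n+2}},\qquad P(q,s)=q^{s^2-s}\prod_{n\ge0}\frac{(1-q^{4n+3-2s})^2}{(1-q^{4n+2})(1-q^{4n+4})}\cdot\frac{1-q^{2s+2n+2}}{1-q^{2n+2}},$$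 and let $C_2(1)$ and $P(1,s)$ be the limits of $C_2(q)$ and $P(q,s)$ as $q\to1^-$. **Theorem.** The product in $P(q,s)$ converges for all $s\in\mathbb C$ and $0<q<1$, and the limits $C_2(1)$ and $P(1,s)$ exist. For all $s\in\mathbb C$ and $q\in(0,1]$ the following series converges and $$\sum_{n=0}^\infty q^{(s-n)(s-n-1)}\binom ns_{q^2}\left(\prod_{j=1}^n\frac{[2j-1]_q}{[2j]_q}\right)^2\frac1{\prod_{j=1}^n(1+q^{2j})}=P(q,s)=C_2(q)\,(1+\mathrm{SinPi})(s,q^2)\binom{s-\frac12}{s}_{q^2}\frac{\Gamma_{q^4}\!\left(\frac{2s+1}4\right)}{\Gamma_{q^4}\!\left(\frac{2s+3}4\right)} .$$ Here, at the points $s$ with $[2s+2m+1]_q=0$ for some integer $m\ge0$, where the last expression has the form $0\cdot\infty$, it is understood as its limit from neighbouring values of $s$. Moreover $C_2(1)=\frac1{\sqrt{2\pi}}$, $(1+\mathrm{SinPi})(s,1)=1+\sin(\pi s)$, and $$P(1,s)=\prod_{n\ge0}\frac{(4n+3-2s)^2(4n+2+2s)(4n+4+2s)}{(4n+2)^2(4n+4)^2}.$$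 For $q=1$ and $s=m$ a non-negative integer, the series equals $\frac1{m!\,2^m}F^{(m)}\!\left(\tfrac12\right)$, where $F(x)=\frac2\pi\int_0^1\frac{dt}{\sqrt{1-t^2}\sqrt{1-xt^2}}$. -/

import Mathlib

open Filter Topology

noncomputable section

/-- The `q`-number `[a]_q = (1 - q^a) / (1 - q)` for complex `a`, with `[a]_1 = a`. A quotient
`[a]_q / [b]_q` is `(1 - q^a) / (1 - q^b)` for `0 < q < 1`, and `a / b` for `q = 1`. -/
def qBracket (q : ℝ) (a : ℂ) : ℂ :=
  if q = 1 then a else (1 - (q : ℂ) ^ a) / (1 - (q : ℂ))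

/-- The `q`-factorial `(α)!_q = (1 - q)^(-α) ∏_{n ≥ 1} (1 - q^n) / (1 - q^(α + n))` for complex `α`,
with `(α)!_1 = Γ(α + 1)`. At a pole its value here is `0`, so that `1 / (α)!_q` is always the value
of the entire function `1 / (α)!_q`. -/
def qFactorial (q : ℝ) (α : ℂ) : ℂ :=
  if q = 1 then Complex.Gamma (α + 1)
  else (1 - (q : ℂ)) ^ (-α) *
    ∏' n : ℕ, (1 - (q : ℂ) ^ (n + 1)) / (1 - (q : ℂ) ^ (α + (n : ℂ) + 1))

/-- The `q`-binomial coefficient `(α)!_q / ((α - β)!_q (β)!_q)`. -/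
def qBinom (q : ℝ) (α β : ℂ) : ℂ :=
  qFactorial q α / (qFactorial q (α - β) * qFactorial q β)

/-- The `q`-Gamma function, `Γ_q(x) = (1 - q)^(1 - x) ∏_{n ≥ 0} (1 - q^(n + 1)) / (1 - q^(x + n))`
and `Γ_1 = Γ`. -/
def qGamma (q : ℝ) (x : ℂ) : ℂ := qFactorial q (x - 1)

/-- The function `(1 + SinPi)(s, q²)`, as a function of `q` and `s`. -/
def onePlusSinPi (q : ℝ) (s : ℂ) : ℂ :=
  (q : ℂ) ^ (s ^ 2 - s) *
    ∏' n : ℕ, (qBracket q (4 * n + 3 - 2 * s) ^ 2 * qBracket q (4 * n + 1 + 2 * s) ^ 2) /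
      (qBracket q (4 * n + 3) ^ 2 * qBracket q (4 * n + 1) ^ 2)

/-- The formula for `C₂(q)`, `0 < q < 1`. -/
def qConstTwoAux (q : ℝ) : ℝ :=
  (1 - q ^ 4) ^ (-(1 / 2) : ℝ) *
    ∏' n : ℕ, (1 - q ^ (2 * n + 1)) / (1 - q ^ (2 * n + 2))

/-- The constant `C₂(q)`; its value at `q = 1` is the limit as `q → 1⁻`. -/
def qConstTwo (q : ℝ) : ℝ :=
  if q = 1 then limUnder (𝓝[<] (1 : ℝ)) qConstTwoAux else qConstTwoAux q

/-- The `n`-th term of the series. -/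
def qSumTerm (q : ℝ) (s : ℂ) (n : ℕ) : ℂ :=
  (q : ℂ) ^ ((s - n) * (s - n - 1)) * qBinom (q ^ 2) n s *
    (∏ j ∈ Finset.Icc 1 n, qBracket q (2 * j - 1) / qBracket q (2 * j)) ^ 2 *
    (1 / ∏ j ∈ Finset.Icc 1 n, (1 + (q : ℂ) ^ (2 * j)))

/-- The `n`-th factor of the infinite product, `0 < q < 1`. -/
def qProdFactor (q : ℝ) (s : ℂ) (n : ℕ) : ℂ :=
  (1 - (q : ℂ) ^ (4 * (n : ℂ) + 3 - 2 * s)) ^ 2 /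
      ((1 - (q : ℂ) ^ (4 * n + 2)) * (1 - (q : ℂ) ^ (4 * n + 4))) *
    ((1 - (q : ℂ) ^ (2 * s + 2 * (n : ℂ) + 2)) / (1 - (q : ℂ) ^ (2 * n + 2)))

/-- The infinite product with its leading power of `q`, `0 < q < 1`. -/
def qProdAux (q : ℝ) (s : ℂ) : ℂ :=
  (q : ℂ) ^ (s ^ 2 - s) * ∏' n : ℕ, qProdFactor q s n

/-- The product side; its value at `q = 1` is the limit as `q → 1⁻`. (Replacing each quotient
`(1 - q^a) / (1 - q^b)` by `a / b` would give this limit divided by `2^s`: passing to the limit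
factor by factor is not legitimate here, since the exponents grow at the two rates `4n`
and `2n`.) -/
def qProdSide (q : ℝ) (s : ℂ) : ℂ :=
  if q = 1 then limUnder (𝓝[<] (1 : ℝ)) (fun p : ℝ => qProdAux p s) else qProdAux q s

/-- The expression through `1 + SinPi`, a `q`-binomial coefficient and `q`-Gamma functions. -/
def qGammaSide (q : ℝ) (s : ℂ) : ℂ :=
  (qConstTwo q : ℂ) * onePlusSinPi q s * qBinom (q ^ 2) (s - 1 / 2) s *
    (qGamma (q ^ 4) ((2 * s + 1) / 4) / qGamma (q ^ 4) ((2 * s + 3) / 4))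

/-- `F(x) = (2/π) ∫₀¹ dt / (√(1 - t²) √(1 - x t²))`, the normalized complete elliptic integral of
the first kind with parameter `x = k²`. -/
def ellipticF (x : ℝ) : ℝ :=
  2 / Real.pi * ∫ t in (0 : ℝ)..1, 1 / (Real.sqrt (1 - t ^ 2) * Real.sqrt (1 - x * t ^ 2))

end

/-!
Both the case `q < 1` and the case `q = 1` rest on a summation formula of Bailey type, and both
formulas are proved in the same way.

For `0 < q < 1` write `(z; Q)_∞` for the infinite Pochhammer symbol `qPoch Q z`. After the
`q`-binomial coefficient is expressed through Pochhammer symbols, the series becomes, up to a factor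
not depending on `n`, the series `∑ Q^{n(n-1)/2} (a; Q)_n (d; Q)_n / (Q²; Q²)_n b^n (b Q^n; Q)_∞`
with `Q = q²`, `a = d = q`, `b = q^{2-2s}` (`qSumTerm_of_lt_one`). If `a d = Q`, this series `G(b)`
satisfies `G(b) = (1 - a b) (1 - d b) G(b Q²)`, because the difference of the two sides telescopes
(`tsum_qBaileyTerm_eq`). Since `G` is continuous at `0` with `G(0) = 1`, iteration gives
`G(b) = (a b; Q²)_∞ (d b; Q²)_∞` (`hasSum_qBaileyTerm`), which is the product side. The expression
through `1 + SinPi` and `q`-Gamma functions is then a rearrangement of Pochhammer symbols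
(`qProdSide_eq_qGammaSide_of_lt_one`). It extends to the exceptional points because these are
isolated and the product side is continuous in `s`.

For `q = 1` the same telescoping relates `₂F₁(1/2, 1/2; c; 1/2) / Γ(c)` at `c` and at `c + 2`
(`tsum_baileyTerm_eq`). Iteration leads to an infinite product of rational functions, which Euler's
limit formula for `Γ` evaluates (`hasProd_gamma_quotient`); the result is `tsum_baileyTerm`.

The limit `q → 1⁻` of the product side is a matter of balanced quotients, namely those with factors
`[n+a][n+b] / ([n+c][n+d])` where `a + b = c + d`. Such a factor is `1 + O(1/n²)` uniformly in the
base, so that the limit may be taken factor by factor (`tendsto_qPoch_quotient`). The product side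
splits into three balanced quotients over the base `q⁴`, and the square of `C₂(q)` is `1 / [4]_q`
times one over the base `q²`.

Finally, `F(x) = ∑ ((1/2)_n / n!)² x^n` for `|x| < 1`, by the substitution `t = cos θ`, the binomial
series and Wallis' integrals (`hasSum_ellipticF`); differentiating `m` times termwise and putting
`x = 1/2` gives the series for `q = 1` and `s = m`.
-/

/-! ### Infinite `q`-Pochhammer symbols -/

/-- The infinite `q`-Pochhammer symbol `(z; Q)_∞ = ∏_{n ≥ 0} (1 - z Q^n)`. -/
noncomputable def qPoch (Q : ℝ) (z : ℂ) : ℂ := ∏' n : ℕ, (1 - z * (Q : ℂ) ^ n)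

section qPoch

variable {Q : ℝ}

lemma summable_norm_mul_pow (h0 : 0 < Q) (h1 : Q < 1) (z : ℂ) :
    Summable fun n : ℕ => ‖-(z * (Q : ℂ) ^ n)‖ := by
  have : ∀ n : ℕ, ‖-(z * (Q : ℂ) ^ n)‖ = ‖z‖ * Q ^ n := fun n => by
    simp [abs_of_pos h0]
  simp_rw [this]
  exact (summable_geometric_of_lt_one h0.le h1).mul_left _

lemma multipliable_qPoch (h0 : 0 < Q) (h1 : Q < 1) (z : ℂ) :
    Multipliable fun n : ℕ => 1 - z * (Q : ℂ) ^ n := by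
  simpa [sub_eq_add_neg] using multipliable_one_add_of_summable (summable_norm_mul_pow h0 h1 z)

lemma hasProd_qPoch (h0 : 0 < Q) (h1 : Q < 1) (z : ℂ) :
    HasProd (fun n : ℕ => 1 - z * (Q : ℂ) ^ n) (qPoch Q z) :=
  (multipliable_qPoch h0 h1 z).hasProd

lemma qPoch_eq_mul (h0 : 0 < Q) (h1 : Q < 1) (z : ℂ) :
    qPoch Q z = (1 - z) * qPoch Q (z * Q) := by
  have h := tprod_eq_zero_mul' (f := fun n : ℕ => 1 - z * (Q : ℂ) ^ n)
    ((multipliable_qPoch h0 h1 (z * Q)).congr fun n => by ring)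
  rw [qPoch, h, qPoch]
  congr 1
  · simp
  · exact tprod_congr fun n => by ring

lemma qPoch_zero : qPoch Q 0 = 1 := by simp [qPoch]

lemma qPoch_ne_zero (h0 : 0 < Q) (h1 : Q < 1) {z : ℂ} (hz : ∀ n : ℕ, 1 - z * (Q : ℂ) ^ n ≠ 0) :
    qPoch Q z ≠ 0 := by
  simpa [qPoch, sub_eq_add_neg] using tprod_one_add_ne_zero_of_summable
    (f := fun n : ℕ => -(z * (Q : ℂ) ^ n)) (fun n => by simpa [sub_eq_add_neg] using hz n)
    (summable_norm_mul_pow h0 h1 z)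

lemma qPoch_ne_zero_of_norm_lt_one (h0 : 0 < Q) (h1 : Q < 1) {z : ℂ} (hz : ‖z‖ < 1) :
    qPoch Q z ≠ 0 := by
  refine qPoch_ne_zero h0 h1 fun n h => ?_
  have h2 : ‖z * (Q : ℂ) ^ n‖ = 1 := by rw [← sub_eq_zero.mp h]; simp
  have h3 : Q ^ n ≤ 1 := pow_le_one₀ h0.le h1.le
  rw [norm_mul, norm_pow, Complex.norm_real, Real.norm_of_nonneg h0.le] at h2
  nlinarith [norm_nonneg z, pow_pos h0 n]

lemma continuous_qPoch (h0 : 0 < Q) (h1 : Q < 1) : Continuous (qPoch Q) := by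
  rw [continuous_iff_continuousAt]
  intro z
  have hb : ∀ᶠ w in 𝓝 z, ∀ n : ℕ, ‖-(w * (Q : ℂ) ^ n)‖ ≤ (‖z‖ + 1) * Q ^ n := by
    filter_upwards [continuous_norm.continuousAt.eventually_lt continuousAt_const
      (show ‖z‖ < ‖z‖ + 1 by linarith)] with w hw n
    rw [norm_neg, norm_mul, norm_pow, Complex.norm_real, Real.norm_of_nonneg h0.le]
    gcongr
  have := tendsto_tprod_one_add_of_dominated_convergence (𝓕 := 𝓝 z)
    (f := fun w (n : ℕ) => -(w * (Q : ℂ) ^ n)) (g := fun n : ℕ => -(z * (Q : ℂ) ^ n))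
    ((summable_geometric_of_lt_one h0.le h1).mul_left (‖z‖ + 1))
    (fun k => (Continuous.tendsto (by fun_prop) z)) hb
  simp_rw [← sub_eq_add_neg] at this
  exact this

lemma exists_bound_qPoch (h0 : 0 < Q) (h1 : Q < 1) (R : ℝ) :
    ∃ K : ℝ, 0 ≤ K ∧ ∀ z : ℂ, ‖z‖ ≤ R → ‖qPoch Q z‖ ≤ K := by
  obtain ⟨K, hK⟩ := (isCompact_closedBall (0 : ℂ) R).exists_bound_of_continuousOn
    (continuous_qPoch h0 h1).continuousOn
  exact ⟨max K 0, le_max_right _ _, fun z hz => (hK z (by simpa using hz)).trans (le_max_left _ _)⟩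

lemma qPoch_sq_mul (h0 : 0 < Q) (h1 : Q < 1) (z : ℂ) :
    qPoch Q z = qPoch (Q ^ 2) z * qPoch (Q ^ 2) (z * Q) := by
  have h0' : 0 < Q ^ 2 := by positivity
  have h1' : Q ^ 2 < 1 := by nlinarith
  have he := hasProd_qPoch h0' h1' z
  have ho := hasProd_qPoch h0' h1' (z * Q)
  refine (HasProd.even_mul_odd (f := fun n : ℕ => 1 - z * (Q : ℂ) ^ n) ?_ ?_).tprod_eq
  · convert he using 3 with n
    push_cast; ring
  · convert ho using 3 with n
    push_cast; ring

/-- Both sides vanish when the numerator or the denominator on the left has a zero factor, so no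
condition on `z` or `w` is needed: a quotient by `0` is `0`. -/
lemma tprod_div_qPoch (h0 : 0 < Q) (h1 : Q < 1) (z w : ℂ) :
    ∏' n : ℕ, (1 - z * (Q : ℂ) ^ n) / (1 - w * (Q : ℂ) ^ n) = qPoch Q z / qPoch Q w := by
  by_cases h : ∃ n : ℕ, 1 - w * (Q : ℂ) ^ n = 0
  · obtain ⟨n, hn⟩ := h
    rw [tprod_of_exists_eq_zero ⟨n, by simp [hn]⟩]
    rw [show qPoch Q w = 0 from tprod_of_exists_eq_zero ⟨n, hn⟩, div_zero]
  · push Not at h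
    exact ((hasProd_qPoch h0 h1 z).div₀ (hasProd_qPoch h0 h1 w) (qPoch_ne_zero h0 h1 h)).tprod_eq

end qPoch

/-! ### The `q`-analogue of Bailey's summation formula -/

section Bailey

variable {Q : ℝ} {a d : ℂ}

/-- The coefficient `Q^{n(n-1)/2} (a; Q)_n (d; Q)_n / (Q²; Q²)_n`. -/
noncomputable def qBaileyCoeff (Q : ℝ) (a d : ℂ) (n : ℕ) : ℂ :=
  ∏ k ∈ Finset.range n,
    (Q : ℂ) ^ k * ((1 - a * (Q : ℂ) ^ k) * (1 - d * (Q : ℂ) ^ k)) / (1 - (Q : ℂ) ^ (2 * k + 2))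

lemma one_sub_ofReal_pow_ne_zero (h0 : 0 < Q) (h1 : Q < 1) {n : ℕ} (hn : n ≠ 0) :
    (1 : ℂ) - (Q : ℂ) ^ n ≠ 0 := by
  have : Q ^ n < 1 := pow_lt_one₀ h0.le h1 hn
  rw [sub_ne_zero]
  exact_mod_cast this.ne'

lemma tendsto_ofReal_pow (h0 : 0 < Q) (h1 : Q < 1) :
    Tendsto (fun n : ℕ => (Q : ℂ) ^ n) atTop (𝓝 0) :=
  tendsto_pow_atTop_nhds_zero_of_norm_lt_one (by simpa [abs_of_pos h0] using h1)

lemma qBaileyCoeff_succ (n : ℕ) : qBaileyCoeff Q a d (n + 1) = qBaileyCoeff Q a d n *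
    ((Q : ℂ) ^ n * ((1 - a * (Q : ℂ) ^ n) * (1 - d * (Q : ℂ) ^ n)) / (1 - (Q : ℂ) ^ (2 * n + 2))) :=
  Finset.prod_range_succ _ _

lemma tendsto_qBaileyCoeff_ratio (h0 : 0 < Q) (h1 : Q < 1) :
    Tendsto (fun k : ℕ => (Q : ℂ) ^ k * ((1 - a * (Q : ℂ) ^ k) * (1 - d * (Q : ℂ) ^ k)) /
      (1 - (Q : ℂ) ^ (2 * k + 2))) atTop (𝓝 0) := by
  have hT := tendsto_ofReal_pow h0 h1
  have hT2 : Tendsto (fun k : ℕ => (Q : ℂ) ^ (2 * k + 2)) atTop (𝓝 0) :=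
    hT.comp (tendsto_atTop_mono (fun k : ℕ => (by omega : k ≤ 2 * k + 2)) tendsto_id)
  have h1' : Tendsto (fun k : ℕ => 1 - (Q : ℂ) ^ (2 * k + 2)) atTop (𝓝 1) := by
    simpa using hT2.const_sub 1
  have h2 : ∀ c : ℂ, Tendsto (fun k : ℕ => 1 - c * (Q : ℂ) ^ k) atTop (𝓝 1) := fun c => by
    simpa using (hT.const_mul c).const_sub 1
  have h := (hT.mul ((h2 a).mul (h2 d))).div h1' one_ne_zero
  rw [zero_mul, zero_div] at h
  exact h

lemma summable_qBaileyCoeff (h0 : 0 < Q) (h1 : Q < 1) (z : ℂ) :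
    Summable fun n => ‖qBaileyCoeff Q a d n * z ^ n‖ := by
  have hlim : Tendsto (fun k : ℕ => ‖(Q : ℂ) ^ k *
      ((1 - a * (Q : ℂ) ^ k) * (1 - d * (Q : ℂ) ^ k)) / (1 - (Q : ℂ) ^ (2 * k + 2)) * z‖)
      atTop (𝓝 0) := by
    simpa using ((tendsto_qBaileyCoeff_ratio (a := a) (d := d) h0 h1).mul_const z).norm
  have hsum : ∀ᶠ n in atTop, ‖qBaileyCoeff Q a d (n + 1) * z ^ (n + 1)‖ ≤
      (1 / 2 : ℝ) * ‖qBaileyCoeff Q a d n * z ^ n‖ := by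
    filter_upwards [hlim.eventually_le_const (by norm_num : (0 : ℝ) < 1 / 2)] with n hn
    rw [qBaileyCoeff_succ, pow_succ z, mul_comm (z ^ n), mul_comm (qBaileyCoeff Q a d n),
      mul_mul_mul_comm, norm_mul]
    exact mul_le_mul_of_nonneg_right hn (norm_nonneg _)
  exact (summable_of_ratio_norm_eventually_le (f := fun n => qBaileyCoeff Q a d n * z ^ n)
    (r := 1 / 2) (by norm_num) hsum).norm

/-- The terms of the series `∑ Q^{n(n-1)/2} (a; Q)_n (d; Q)_n / (Q²; Q²)_n b^n (b Q^n; Q)_∞`, which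
is `(b; Q)_∞` times a `₂φ₂` and, unlike the latter, is entire in `b`. -/
noncomputable def qBaileyTerm (Q : ℝ) (a d b : ℂ) (n : ℕ) : ℂ :=
  qBaileyCoeff Q a d n * b ^ n * qPoch Q (b * (Q : ℂ) ^ n)

lemma exists_bound_qBailey (h0 : 0 < Q) (h1 : Q < 1) (R : ℝ) (i : ℕ) :
    ∃ K : ℝ, ∀ b : ℂ, ‖b‖ ≤ R → ∀ n,
      ‖qBaileyCoeff Q a d n * b ^ n * qPoch Q (b * (Q : ℂ) ^ (n + i))‖ ≤
        ‖qBaileyCoeff Q a d n * (R : ℂ) ^ n‖ * K := by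
  obtain ⟨K, hK0, hK⟩ := exists_bound_qPoch h0 h1 R
  refine ⟨K, fun b hb n => ?_⟩
  have hR : 0 ≤ R := (norm_nonneg b).trans hb
  have h3 : Q ^ (n + i) ≤ 1 := pow_le_one₀ h0.le h1.le
  have h4 := hK (b * (Q : ℂ) ^ (n + i)) (by
    rw [norm_mul, norm_pow, Complex.norm_real, Real.norm_of_nonneg h0.le]
    nlinarith [norm_nonneg b, pow_pos h0 (n + i)])
  rw [norm_mul, norm_mul, norm_mul, norm_pow, norm_pow, Complex.norm_real, Real.norm_of_nonneg hR]
  gcongr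

lemma summable_qBailey (h0 : 0 < Q) (h1 : Q < 1) (b : ℂ) (i : ℕ) :
    Summable fun n => qBaileyCoeff Q a d n * b ^ n * qPoch Q (b * (Q : ℂ) ^ (n + i)) := by
  obtain ⟨K, hK⟩ := exists_bound_qBailey (a := a) (d := d) h0 h1 ‖b‖ i
  exact Summable.of_norm_bounded 
    ((summable_qBaileyCoeff (a := a) (d := d) h0 h1 (‖b‖ : ℂ)).mul_right K) (hK b le_rfl)

lemma summable_qBaileyTerm (h0 : 0 < Q) (h1 : Q < 1) (b : ℂ) :
    Summable (qBaileyTerm Q a d b) := summable_qBailey h0 h1 b 0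

/-- The functional equation of the series: the difference of the two sides telescopes, with the
certificate `-(1 - Q^{2n}) / (1 - b Q^n)` times the `n`-th term. -/
lemma tsum_qBaileyTerm_eq (h0 : 0 < Q) (h1 : Q < 1) (had : a * d = Q) (b : ℂ) :
    ∑' n, qBaileyTerm Q a d b n =
      (1 - a * b) * (1 - d * b) * ∑' n, qBaileyTerm Q a d (b * (Q : ℂ) ^ 2) n := by
  set g : ℕ → ℂ := fun n => -(1 - (Q : ℂ) ^ (2 * n)) *
    (qBaileyCoeff Q a d n * b ^ n * qPoch Q (b * (Q : ℂ) ^ (n + 1))) with hg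
  have hstep : ∀ n, qBaileyTerm Q a d b n -
      (1 - a * b) * (1 - d * b) * qBaileyTerm Q a d (b * (Q : ℂ) ^ 2) n = g (n + 1) - g n := by
    intro n
    have e1 : qPoch Q (b * (Q : ℂ) ^ n) =
        (1 - b * (Q : ℂ) ^ n) * qPoch Q (b * (Q : ℂ) ^ (n + 1)) := by
      rw [qPoch_eq_mul h0 h1]; ring_nf
    have e2 : qPoch Q (b * (Q : ℂ) ^ (n + 1)) =
        (1 - b * (Q : ℂ) ^ (n + 1)) * qPoch Q (b * (Q : ℂ) ^ (n + 2)) := by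
      rw [qPoch_eq_mul h0 h1]; ring_nf
    have e3 : qBaileyCoeff Q a d (n + 1) * (1 - (Q : ℂ) ^ (2 * (n + 1))) =
        qBaileyCoeff Q a d n * ((Q : ℂ) ^ n * ((1 - a * (Q : ℂ) ^ n) * (1 - d * (Q : ℂ) ^ n))) := by
      have := one_sub_ofReal_pow_ne_zero h0 h1 (n := 2 * n + 2) (by omega)
      rw [qBaileyCoeff_succ, mul_add, mul_one, mul_assoc,
        div_mul_cancel₀ _ this]
    have e4 : b * (Q : ℂ) ^ 2 * (Q : ℂ) ^ n = b * (Q : ℂ) ^ (n + 2) := by ring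
    have e5 : g (n + 1) = -(qBaileyCoeff Q a d (n + 1) * (1 - (Q : ℂ) ^ (2 * (n + 1)))) *
        b ^ (n + 1) * qPoch Q (b * (Q : ℂ) ^ (n + 2)) := by
      simp only [hg]; ring
    rw [e5, e3]
    simp only [qBaileyTerm, hg]
    rw [e4, e1, e2]
    generalize qPoch Q (b * (Q : ℂ) ^ (n + 2)) = E
    have : (Q : ℂ) ^ (2 * n) = ((Q : ℂ) ^ n) ^ 2 := by ring
    rw [this, pow_succ (Q : ℂ) n, mul_pow, ← pow_mul, mul_comm 2 n, pow_mul, pow_succ b n]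
    generalize (Q : ℂ) ^ n = x
    rw [← had]
    ring
  have hs1 := summable_qBaileyTerm (a := a) (d := d) h0 h1 b
  have hs2 := summable_qBaileyTerm (a := a) (d := d) h0 h1 (b * (Q : ℂ) ^ 2)
  have hgs : Summable g := by
    obtain ⟨K, hK⟩ := exists_bound_qBailey (a := a) (d := d) h0 h1 ‖b‖ 1
    refine Summable.of_norm_bounded 
      ((summable_qBaileyCoeff (a := a) (d := d) h0 h1 (‖b‖ : ℂ)).mul_right K) fun n => ?_
    have hle : ‖-(1 - (Q : ℂ) ^ (2 * n))‖ ≤ 1 := by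
      have h3 : Q ^ (2 * n) ≤ 1 := pow_le_one₀ h0.le h1.le
      rw [norm_neg,
        show (1 : ℂ) - (Q : ℂ) ^ (2 * n) = ((1 - Q ^ (2 * n) : ℝ) : ℂ) by push_cast; rfl,
        Complex.norm_real, Real.norm_of_nonneg (by linarith)]
      linarith [pow_pos h0 (2 * n)]
    simp only [hg]
    rw [norm_mul]
    exact (mul_le_of_le_one_left (norm_nonneg _) hle).trans (hK b le_rfl n)
  have hg0 : g 0 = 0 := by simp [hg]
  have h4 := hgs.tsum_eq_zero_add
  have h5 : ∑' n, (g (n + 1) - g n) = 0 := by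
    rw [((summable_nat_add_iff 1).2 hgs).tsum_sub hgs, h4, hg0]; ring
  rw [← sub_eq_zero, ← tsum_mul_left, ← hs1.tsum_sub (hs2.mul_left _), ← h5]
  exact tsum_congr hstep

lemma tendsto_tsum_qBaileyTerm (h0 : 0 < Q) (h1 : Q < 1) :
    Tendsto (fun b => ∑' n, qBaileyTerm Q a d b n) (𝓝 0) (𝓝 1) := by
  obtain ⟨K, hK⟩ := exists_bound_qBailey (a := a) (d := d) h0 h1 1 0
  have h := tendsto_tsum_of_dominated_convergence (𝓕 := 𝓝 (0 : ℂ)) (f := qBaileyTerm Q a d)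
    (g := qBaileyTerm Q a d 0) ((summable_qBaileyCoeff (a := a) (d := d) h0 h1 (1 : ℝ)).mul_right K)
    (fun n => by
      have := continuous_qPoch h0 h1
      exact Continuous.tendsto (by unfold qBaileyTerm; fun_prop) 0) (by
      filter_upwards [Metric.closedBall_mem_nhds (0 : ℂ) one_pos] with b hb
      exact hK b (by simpa using hb))
  rwa [tsum_eq_single 0 (fun n hn => by simp [qBaileyTerm, hn]), qBaileyTerm, pow_zero, zero_mul,
    qPoch_zero, qBaileyCoeff, Finset.prod_range_zero, mul_one, mul_one] at h

/-- The `q`-analogue of Bailey's summation formula. -/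
theorem hasSum_qBaileyTerm (h0 : 0 < Q) (h1 : Q < 1) (had : a * d = Q) (b : ℂ) :
    HasSum (qBaileyTerm Q a d b) (qPoch (Q ^ 2) (a * b) * qPoch (Q ^ 2) (d * b)) := by
  have h0' : 0 < Q ^ 2 := by positivity
  have h1' : Q ^ 2 < 1 := by nlinarith
  have hiter : ∀ N : ℕ, ∑' n, qBaileyTerm Q a d b n =
      (∏ k ∈ Finset.range N, (1 - a * b * ((Q ^ 2 : ℝ) : ℂ) ^ k)) *
      (∏ k ∈ Finset.range N, (1 - d * b * ((Q ^ 2 : ℝ) : ℂ) ^ k)) *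
        ∑' n, qBaileyTerm Q a d (b * ((Q ^ 2 : ℝ) : ℂ) ^ N) n := by
    intro N
    induction N with
    | zero => simp
    | succ N ih =>
      rw [ih, Finset.prod_range_succ, Finset.prod_range_succ, tsum_qBaileyTerm_eq h0 h1 had,
        show b * ((Q ^ 2 : ℝ) : ℂ) ^ (N + 1) = b * ((Q ^ 2 : ℝ) : ℂ) ^ N * (Q : ℂ) ^ 2 by
          push_cast; ring]
      ring
  have hl := ((hasProd_qPoch h0' h1' (a * b)).tendsto_prod_nat.mul
    (hasProd_qPoch h0' h1' (d * b)).tendsto_prod_nat).mul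
    ((tendsto_tsum_qBaileyTerm (a := a) (d := d) h0 h1).comp
      (show Tendsto (fun N : ℕ => b * ((Q ^ 2 : ℝ) : ℂ) ^ N) atTop (𝓝 0) by
        simpa using (tendsto_ofReal_pow h0' h1').const_mul b))
  rw [mul_one] at hl
  have := tendsto_nhds_unique (tendsto_const_nhds (x := ∑' n, qBaileyTerm Q a d b n))
    (hl.congr fun N => (hiter N).symm)
  rw [← this]
  exact (summable_qBaileyTerm h0 h1 b).hasSum

end Bailey

/-! ### The `q`-functions for `0 < q < 1` in terms of Pochhammer symbols -/

section LtOne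

variable {q : ℝ}

lemma ofReal_pow_cpow (h0 : 0 < q) (k : ℕ) (α : ℂ) :
    ((q ^ k : ℝ) : ℂ) ^ α = (q : ℂ) ^ (k * α) := by
  have hq : (q : ℂ) ≠ 0 := by exact_mod_cast h0.ne'
  have hqk : ((q ^ k : ℝ) : ℂ) ≠ 0 := by exact_mod_cast (pow_pos h0 k).ne'
  rw [Complex.cpow_def_of_ne_zero hq, Complex.cpow_def_of_ne_zero hqk, ← Complex.ofReal_log h0.le,
    ← Complex.ofReal_log (pow_pos h0 k).le, Real.log_pow]
  push_cast
  ring_nf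

lemma cpow_add_natCast_mul (h0 : 0 < q) (z : ℂ) (k n : ℕ) :
    (q : ℂ) ^ (z + k * n) = (q : ℂ) ^ z * ((q ^ k : ℝ) : ℂ) ^ n := by
  have hq : (q : ℂ) ≠ 0 := by exact_mod_cast h0.ne'
  rw [Complex.cpow_add _ _ hq]
  congr 1
  rw [← Nat.cast_mul, Complex.cpow_natCast, pow_mul]
  push_cast
  rfl

lemma cpow_add_natCast (h0 : 0 < q) (z : ℂ) (n : ℕ) :
    (q : ℂ) ^ (z + n) = (q : ℂ) ^ z * (q : ℂ) ^ n := by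
  simpa using cpow_add_natCast_mul h0 z 1 n

lemma qFactorial_of_lt_one (h0 : 0 < q) (h1 : q < 1) (α : ℂ) :
    qFactorial q α = (1 - (q : ℂ)) ^ (-α) * (qPoch q q / qPoch q ((q : ℂ) ^ (α + 1))) := by
  rw [qFactorial, if_neg h1.ne, ← tprod_div_qPoch h0 h1]
  congr 1
  refine tprod_congr fun n => ?_
  rw [add_right_comm, cpow_add_natCast h0, pow_succ']

lemma one_sub_ofReal_ne_zero (h1 : q < 1) : (1 : ℂ) - q ≠ 0 := by
  rw [sub_ne_zero]; exact_mod_cast h1.ne'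

lemma qPoch_self_ne_zero (h0 : 0 < q) (h1 : q < 1) {k m : ℕ} (hk : k ≠ 0) (hm : m ≠ 0) :
    qPoch (q ^ k) ((q : ℂ) ^ m) ≠ 0 := by
  refine qPoch_ne_zero_of_norm_lt_one (by positivity) (pow_lt_one₀ h0.le h1 hk) ?_
  rw [norm_pow, Complex.norm_real, Real.norm_of_nonneg h0.le]
  exact pow_lt_one₀ h0.le h1 hm

lemma qBinom_of_lt_one (h0 : 0 < q) (h1 : q < 1) (α β : ℂ) :
    qBinom q α β = qPoch q ((q : ℂ) ^ (α - β + 1)) * qPoch q ((q : ℂ) ^ (β + 1)) /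
      (qPoch q q * qPoch q ((q : ℂ) ^ (α + 1))) := by
  have hP : qPoch q q ≠ 0 := by simpa using qPoch_self_ne_zero h0 h1 one_ne_zero one_ne_zero
  have hc : (1 - (q : ℂ)) ^ (-α) = (1 - (q : ℂ)) ^ (-(α - β)) * (1 - (q : ℂ)) ^ (-β) := by
    rw [← Complex.cpow_add _ _ (one_sub_ofReal_ne_zero h1)]; ring_nf
  have hc1 : (1 - (q : ℂ)) ^ (-(α - β)) ≠ 0 := by
    simp [Complex.cpow_eq_zero_iff, one_sub_ofReal_ne_zero h1]
  have hc2 : (1 - (q : ℂ)) ^ (-β) ≠ 0 := by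
    simp [Complex.cpow_eq_zero_iff, one_sub_ofReal_ne_zero h1]
  rw [qBinom, qFactorial_of_lt_one h0 h1, qFactorial_of_lt_one h0 h1,
    qFactorial_of_lt_one h0 h1, hc]
  generalize (1 - (q : ℂ)) ^ (-(α - β)) = u at *
  generalize (1 - (q : ℂ)) ^ (-β) = v at *
  simp only [div_eq_mul_inv, mul_inv, inv_inv]
  field_simp

lemma qPoch_self_eq_prod_mul (h0 : 0 < q) (h1 : q < 1) (n : ℕ) :
    qPoch q q = (∏ k ∈ Finset.range n, (1 - (q : ℂ) ^ (k + 1))) * qPoch q ((q : ℂ) ^ (n + 1)) := by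
  induction n with
  | zero => simp
  | succ n ih =>
    rw [ih, Finset.prod_range_succ, mul_assoc, qPoch_eq_mul h0 h1 ((q : ℂ) ^ (n + 1)), ← pow_succ]

/-- Up to the `q`-binomial coefficient, the terms of the series are those of the `q`-analogue of
Bailey's formula with base `q²` and `a = d = q`, `b = q^{2 - 2s}`. -/
lemma qSumTerm_coeff (h0 : 0 < q) (h1 : q < 1) (s : ℂ) (n : ℕ) :
    (q : ℂ) ^ ((s - n) * (s - n - 1)) *
      (∏ j ∈ Finset.Icc 1 n, qBracket q (2 * j - 1) / qBracket q (2 * j)) ^ 2 *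
      (1 / ∏ j ∈ Finset.Icc 1 n, (1 + (q : ℂ) ^ (2 * j))) *
      ∏ k ∈ Finset.range n, (1 - ((q ^ 2 : ℝ) : ℂ) ^ (k + 1)) =
    (q : ℂ) ^ (s ^ 2 - s) * (qBaileyCoeff (q ^ 2) q q n * ((q : ℂ) ^ (2 - 2 * s)) ^ n) := by
  have hq : (q : ℂ) ≠ 0 := by exact_mod_cast h0.ne'
  induction n with
  | zero => simp [qBaileyCoeff]; ring_nf
  | succ n ih =>
    have e1 : (q : ℂ) ^ ((s - (n + 1 : ℕ)) * (s - (n + 1 : ℕ) - 1)) =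
        (q : ℂ) ^ ((s - n) * (s - n - 1)) * ((q : ℂ) ^ (2 - 2 * s) * ((q ^ 2 : ℝ) : ℂ) ^ n) := by
      rw [← cpow_add_natCast_mul h0, ← Complex.cpow_add _ _ hq]
      push_cast; ring_nf
    have e2 : qBracket q (2 * (n + 1 : ℕ) - 1) / qBracket q (2 * (n + 1 : ℕ)) =
        (1 - (q : ℂ) ^ (2 * n + 1)) / (1 - (q : ℂ) ^ (2 * n + 2)) := by
      rw [qBracket, qBracket, if_neg h1.ne, if_neg h1.ne,
        div_div_div_cancel_right₀ (one_sub_ofReal_ne_zero h1),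
        ← Complex.cpow_natCast _ (2 * n + 1), ← Complex.cpow_natCast _ (2 * n + 2)]
      push_cast; ring_nf
    have h2 := one_sub_ofReal_pow_ne_zero h0 h1 (n := 2 * n + 2) (by omega)
    have h3 : (1 : ℂ) + (q : ℂ) ^ (2 * n + 2) ≠ 0 := by
      exact_mod_cast (by positivity : (1 : ℝ) + q ^ (2 * n + 2) ≠ 0)
    rw [Finset.prod_Icc_succ_top (by omega), Finset.prod_Icc_succ_top (by omega),
      Finset.prod_range_succ, e1, e2, qBaileyCoeff_succ, pow_succ ((q : ℂ) ^ (2 - 2 * s))]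
    have e3 : (q : ℂ) ^ (2 - 2 * s) * ((q ^ 2 : ℝ) : ℂ) ^ n *
        ((1 - (q : ℂ) ^ (2 * n + 1)) / (1 - (q : ℂ) ^ (2 * n + 2))) ^ 2 *
        (1 / (1 + (q : ℂ) ^ (2 * (n + 1)))) * (1 - ((q ^ 2 : ℝ) : ℂ) ^ (n + 1)) =
        ((q ^ 2 : ℝ) : ℂ) ^ n * ((1 - (q : ℂ) * ((q ^ 2 : ℝ) : ℂ) ^ n) *
          (1 - (q : ℂ) * ((q ^ 2 : ℝ) : ℂ) ^ n)) / (1 - ((q ^ 2 : ℝ) : ℂ) ^ (2 * n + 2)) *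
          (q : ℂ) ^ (2 - 2 * s) := by
      have e4 : ((q ^ 2 : ℝ) : ℂ) ^ (2 * n + 2) = ((q : ℂ) ^ (2 * n + 2)) ^ 2 := by
        push_cast; ring
      have e5 : ((q ^ 2 : ℝ) : ℂ) ^ (n + 1) = (q : ℂ) ^ (2 * n + 2) := by push_cast; ring
      have e6 : (q : ℂ) * ((q ^ 2 : ℝ) : ℂ) ^ n = (q : ℂ) ^ (2 * n + 1) := by push_cast; ring
      rw [e4, e5, e6, show 2 * (n + 1) = 2 * n + 2 by ring,
        show (1 : ℂ) - ((q : ℂ) ^ (2 * n + 2)) ^ 2 =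
          (1 - (q : ℂ) ^ (2 * n + 2)) * (1 + (q : ℂ) ^ (2 * n + 2)) by ring]
      field_simp
    calc _ = ((q : ℂ) ^ ((s - n) * (s - n - 1)) *
      (∏ j ∈ Finset.Icc 1 n, qBracket q (2 * j - 1) / qBracket q (2 * j)) ^ 2 *
      (1 / ∏ j ∈ Finset.Icc 1 n, (1 + (q : ℂ) ^ (2 * j))) *
      ∏ k ∈ Finset.range n, (1 - ((q ^ 2 : ℝ) : ℂ) ^ (k + 1))) *
        ((q : ℂ) ^ (2 - 2 * s) * ((q ^ 2 : ℝ) : ℂ) ^ n *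
        ((1 - (q : ℂ) ^ (2 * n + 1)) / (1 - (q : ℂ) ^ (2 * n + 2))) ^ 2 *
        (1 / (1 + (q : ℂ) ^ (2 * (n + 1)))) * (1 - ((q ^ 2 : ℝ) : ℂ) ^ (n + 1))) := by
          rw [mul_pow, ← one_div_mul_one_div]; ring
      _ = _ := by rw [ih, e3]; ring

lemma qSumTerm_of_lt_one (h0 : 0 < q) (h1 : q < 1) (s : ℂ) (n : ℕ) :
    qSumTerm q s n = (q : ℂ) ^ (s ^ 2 - s) * qPoch (q ^ 2) ((q : ℂ) ^ (2 * s + 2)) /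
      qPoch (q ^ 2) ((q : ℂ) ^ 2) ^ 2 * qBaileyTerm (q ^ 2) q q ((q : ℂ) ^ (2 - 2 * s)) n := by
  have hq0 : 0 < q ^ 2 := by positivity
  have hq1 : q ^ 2 < 1 := pow_lt_one₀ h0.le h1 two_ne_zero
  have hP := qPoch_self_ne_zero h0 h1 two_ne_zero (two_ne_zero)
  have hPn := qPoch_self_ne_zero h0 h1 two_ne_zero (m := 2 * n + 2) (by omega)
  have e1 : qBinom (q ^ 2) n s =
      qPoch (q ^ 2) ((q : ℂ) ^ (2 - 2 * s) * ((q ^ 2 : ℝ) : ℂ) ^ n) *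
        qPoch (q ^ 2) ((q : ℂ) ^ (2 * s + 2)) /
      (qPoch (q ^ 2) ((q : ℂ) ^ 2) * qPoch (q ^ 2) ((q : ℂ) ^ (2 * n + 2))) := by
    rw [qBinom_of_lt_one hq0 hq1, ofReal_pow_cpow h0, ofReal_pow_cpow h0, ofReal_pow_cpow h0,
      ← cpow_add_natCast_mul h0, ← Complex.cpow_natCast _ (2 * n + 2)]
    push_cast
    ring_nf
  have e2 := qPoch_self_eq_prod_mul hq0 hq1 n
  rw [show ((q ^ 2 : ℝ) : ℂ) ^ (n + 1) = (q : ℂ) ^ (2 * n + 2) by push_cast; ring,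
    Complex.ofReal_pow] at e2
  have e3 := qSumTerm_coeff h0 h1 s n
  rw [Complex.ofReal_pow] at e3
  rw [qSumTerm, qBaileyTerm, e1]
  set A := qPoch (q ^ 2) ((q : ℂ) ^ (2 - 2 * s) * ((q ^ 2 : ℝ) : ℂ) ^ n)
  set B := qPoch (q ^ 2) ((q : ℂ) ^ (2 * s + 2))
  set Pn := qPoch (q ^ 2) ((q : ℂ) ^ (2 * n + 2))
  set P := qPoch (q ^ 2) ((q : ℂ) ^ 2)
  set X := ∏ k ∈ Finset.range n, (1 - ((q : ℂ) ^ 2) ^ (k + 1))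
  have hX : X ≠ 0 := fun h => hP (by rw [e2, h, zero_mul])
  have e4 : (q : ℂ) ^ (s ^ 2 - s) * B / P ^ 2 *
      (qBaileyCoeff (q ^ 2) q q n * ((q : ℂ) ^ (2 - 2 * s)) ^ n * A) =
      ((q : ℂ) ^ (s ^ 2 - s) * (qBaileyCoeff (q ^ 2) q q n * ((q : ℂ) ^ (2 - 2 * s)) ^ n)) *
      (A * B / P ^ 2) := by ring
  rw [e4, ← e3, e2]
  field_simp

lemma hasProd_qProdFactor (h0 : 0 < q) (h1 : q < 1) (s : ℂ) :
    HasProd (qProdFactor q s) (qPoch (q ^ 4) ((q : ℂ) ^ (3 - 2 * s)) ^ 2 *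
      qPoch (q ^ 2) ((q : ℂ) ^ (2 * s + 2)) / qPoch (q ^ 2) ((q : ℂ) ^ 2) ^ 2) := by
  have h20 : 0 < q ^ 2 := by positivity
  have h21 : q ^ 2 < 1 := pow_lt_one₀ h0.le h1 two_ne_zero
  have h40 : 0 < q ^ 4 := by positivity
  have h41 : q ^ 4 < 1 := pow_lt_one₀ h0.le h1 four_ne_zero
  have a1 := hasProd_qPoch h40 h41 ((q : ℂ) ^ (3 - 2 * s))
  have a2 := (hasProd_qPoch h40 h41 ((q : ℂ) ^ 2)).mul (hasProd_qPoch h40 h41 ((q : ℂ) ^ 4))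
  have a3 := (hasProd_qPoch h20 h21 ((q : ℂ) ^ (2 * s + 2))).div₀
    (hasProd_qPoch h20 h21 ((q : ℂ) ^ 2)) (qPoch_self_ne_zero h0 h1 two_ne_zero two_ne_zero)
  have a4 := ((a1.mul a1).div₀ a2 (mul_ne_zero
    (qPoch_self_ne_zero h0 h1 four_ne_zero two_ne_zero)
    (qPoch_self_ne_zero h0 h1 four_ne_zero four_ne_zero))).mul a3
  have e := qPoch_sq_mul h20 h21 ((q : ℂ) ^ 2)
  rw [show (q ^ 2) ^ 2 = q ^ 4 by ring,
    show (q : ℂ) ^ 2 * ((q ^ 2 : ℝ) : ℂ) = (q : ℂ) ^ 4 by push_cast; ring] at e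
  rw [← e] at a4
  rw [show qPoch (q ^ 4) ((q : ℂ) ^ (3 - 2 * s)) ^ 2 * qPoch (q ^ 2) ((q : ℂ) ^ (2 * s + 2)) /
      qPoch (q ^ 2) ((q : ℂ) ^ 2) ^ 2 = qPoch (q ^ 4) ((q : ℂ) ^ (3 - 2 * s)) *
      qPoch (q ^ 4) ((q : ℂ) ^ (3 - 2 * s)) / qPoch (q ^ 2) ((q : ℂ) ^ 2) *
      (qPoch (q ^ 2) ((q : ℂ) ^ (2 * s + 2)) / qPoch (q ^ 2) ((q : ℂ) ^ 2)) by ring]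
  refine a4.congr_fun fun n => ?_
  have e1 : (q : ℂ) ^ (4 * n + 2) = (q : ℂ) ^ 2 * ((q ^ 4 : ℝ) : ℂ) ^ n := by push_cast; ring
  have e2 : (q : ℂ) ^ (4 * n + 4) = (q : ℂ) ^ 4 * ((q ^ 4 : ℝ) : ℂ) ^ n := by push_cast; ring
  have e3 : (q : ℂ) ^ (2 * n + 2) = (q : ℂ) ^ 2 * ((q ^ 2 : ℝ) : ℂ) ^ n := by push_cast; ring
  rw [qProdFactor, e1, e2, e3,
    show 4 * (n : ℂ) + 3 - 2 * s = 3 - 2 * s + (4 : ℕ) * n by push_cast; ring,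
    show 2 * s + 2 * (n : ℂ) + 2 = 2 * s + 2 + (2 : ℕ) * n by push_cast; ring,
    cpow_add_natCast_mul h0, cpow_add_natCast_mul h0, pow_two (1 - _)]

lemma qProdSide_of_lt_one (h0 : 0 < q) (h1 : q < 1) (s : ℂ) :
    qProdSide q s = (q : ℂ) ^ (s ^ 2 - s) * (qPoch (q ^ 4) ((q : ℂ) ^ (3 - 2 * s)) ^ 2 *
      qPoch (q ^ 2) ((q : ℂ) ^ (2 * s + 2)) / qPoch (q ^ 2) ((q : ℂ) ^ 2) ^ 2) := by
  rw [qProdSide, if_neg h1.ne, qProdAux, (hasProd_qProdFactor h0 h1 s).tprod_eq]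

lemma hasSum_qSumTerm_of_lt_one (h0 : 0 < q) (h1 : q < 1) (s : ℂ) :
    HasSum (qSumTerm q s) (qProdSide q s) := by
  have hq : (q : ℂ) ≠ 0 := by exact_mod_cast h0.ne'
  have h := hasSum_qBaileyTerm (Q := q ^ 2) (a := q) (d := q) (by positivity)
    (pow_lt_one₀ h0.le h1 two_ne_zero) (by push_cast; ring) ((q : ℂ) ^ (2 - 2 * s))
  have e : (q : ℂ) * (q : ℂ) ^ (2 - 2 * s) = (q : ℂ) ^ (3 - 2 * s) := by
    rw [show 3 - 2 * s = 2 - 2 * s + (1 : ℕ) by push_cast; ring, cpow_add_natCast h0, pow_one,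
      mul_comm]
  rw [e, show (q ^ 2) ^ 2 = q ^ 4 by ring] at h
  have h' := h.mul_left ((q : ℂ) ^ (s ^ 2 - s) * qPoch (q ^ 2) ((q : ℂ) ^ (2 * s + 2)) /
      qPoch (q ^ 2) ((q : ℂ) ^ 2) ^ 2)
  rw [funext (qSumTerm_of_lt_one h0 h1 s), qProdSide_of_lt_one h0 h1]
  refine Eq.subst (motive := fun x => HasSum _ x) ?_ h'
  ring

lemma continuous_qProdSide_of_lt_one (h0 : 0 < q) (h1 : q < 1) : Continuous (qProdSide q) := by
  have hq : (q : ℂ) ≠ 0 := by exact_mod_cast h0.ne'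
  rw [funext (qProdSide_of_lt_one h0 h1)]
  have c2 := continuous_qPoch (Q := q ^ 2) (by positivity) (pow_lt_one₀ h0.le h1 two_ne_zero)
  have c4 := continuous_qPoch (Q := q ^ 4) (by positivity) (pow_lt_one₀ h0.le h1 four_ne_zero)
  have hc : ∀ f : ℂ → ℂ, Continuous f → Continuous fun s => (q : ℂ) ^ f s :=
    fun f hf => hf.const_cpow (Or.inl hq)
  exact (hc _ (by fun_prop)).mul ((((c4.comp (hc _ (by fun_prop))).pow 2).mul
    (c2.comp (hc _ (by fun_prop)))).div_const _)

lemma onePlusSinPi_of_lt_one (h0 : 0 < q) (h1 : q < 1) (s : ℂ) :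
    onePlusSinPi q s = (q : ℂ) ^ (s ^ 2 - s) *
      ((qPoch (q ^ 4) ((q : ℂ) ^ (3 - 2 * s)) ^ 2 * qPoch (q ^ 4) ((q : ℂ) ^ (2 * s + 1)) ^ 2) /
        qPoch (q ^ 2) q ^ 2) := by
  have h20 : 0 < q ^ 2 := by positivity
  have h21 : q ^ 2 < 1 := pow_lt_one₀ h0.le h1 two_ne_zero
  have h40 : 0 < q ^ 4 := by positivity
  have h41 : q ^ 4 < 1 := pow_lt_one₀ h0.le h1 four_ne_zero
  have n1 : qPoch (q ^ 4) (q : ℂ) ≠ 0 := by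
    simpa using qPoch_self_ne_zero h0 h1 four_ne_zero one_ne_zero
  have n3 := qPoch_self_ne_zero h0 h1 four_ne_zero three_ne_zero
  have a1 := hasProd_qPoch h40 h41 ((q : ℂ) ^ (3 - 2 * s))
  have a2 := hasProd_qPoch h40 h41 ((q : ℂ) ^ (2 * s + 1))
  have b1 := hasProd_qPoch h40 h41 ((q : ℂ) ^ 3)
  have b2 := hasProd_qPoch h40 h41 (q : ℂ)
  have a4 := (((a1.mul a1).mul (a2.mul a2)).div₀ ((b1.mul b1).mul (b2.mul b2))
    (mul_ne_zero (mul_ne_zero n3 n3) (mul_ne_zero n1 n1))).tprod_eq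
  have e := qPoch_sq_mul h20 h21 (q : ℂ)
  rw [show (q ^ 2) ^ 2 = q ^ 4 by ring,
    show (q : ℂ) * ((q ^ 2 : ℝ) : ℂ) = (q : ℂ) ^ 3 by push_cast; ring] at e
  rw [onePlusSinPi, e]
  congr 1
  refine Eq.trans (tprod_congr fun n => ?_) (a4.trans ?_)
  swap
  · ring
  have hne := one_sub_ofReal_ne_zero h1
  simp only [qBracket, if_neg h1.ne, div_pow]
  rw [show 4 * (n : ℂ) + 3 - 2 * s = 3 - 2 * s + (4 : ℕ) * n by push_cast; ring,
    show 4 * (n : ℂ) + 1 + 2 * s = 2 * s + 1 + (4 : ℕ) * n by push_cast; ring,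
    show 4 * (n : ℂ) + 3 = (3 : ℕ) + (4 : ℕ) * n by push_cast; ring,
    show 4 * (n : ℂ) + 1 = 1 + (4 : ℕ) * n by push_cast; ring,
    cpow_add_natCast_mul h0, cpow_add_natCast_mul h0, cpow_add_natCast_mul h0,
    cpow_add_natCast_mul h0, Complex.cpow_natCast, Complex.cpow_one, div_mul_div_comm,
    div_mul_div_comm,
    div_div_div_cancel_right₀ (mul_ne_zero (pow_ne_zero 2 hne) (pow_ne_zero 2 hne))]
  ring

lemma tprod_ofReal_eq_of_hasProd {f : ℕ → ℝ} {z : ℂ} (h : HasProd (fun n => (f n : ℂ)) z) :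
    ((∏' n, f n : ℝ) : ℂ) = z := by
  have h1 : HasProd f z.re := by
    refine ((Complex.continuous_re.tendsto z).comp h).congr fun t => ?_
    simp only [Function.comp_apply, ← Complex.ofReal_prod, Complex.ofReal_re]
  have h2 := h1.map Complex.ofRealHom Complex.continuous_ofReal
  rw [h1.tprod_eq]
  exact h2.unique h

lemma qConstTwo_of_lt_one (h0 : 0 < q) (h1 : q < 1) :
    (qConstTwo q : ℂ) = (1 - ((q ^ 4 : ℝ) : ℂ)) ^ (-(1 / 2) : ℂ) *
      (qPoch (q ^ 2) q / qPoch (q ^ 2) ((q : ℂ) ^ 2)) := by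
  have h20 : 0 < q ^ 2 := by positivity
  have h21 : q ^ 2 < 1 := pow_lt_one₀ h0.le h1 two_ne_zero
  have h41 : q ^ 4 < 1 := pow_lt_one₀ h0.le h1 four_ne_zero
  rw [qConstTwo, if_neg h1.ne, qConstTwoAux, Complex.ofReal_mul, Complex.ofReal_cpow (by linarith),
    tprod_ofReal_eq_of_hasProd (HasProd.congr_fun
      ((hasProd_qPoch h20 h21 (q : ℂ)).div₀ (hasProd_qPoch h20 h21 ((q : ℂ) ^ 2))
        (qPoch_self_ne_zero h0 h1 two_ne_zero two_ne_zero)) (fun n => ?_))]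
  · push_cast; rfl
  · push_cast
    rw [← pow_mul, ← pow_succ', ← pow_add, add_comm 2]

/-- The `q`-Gamma functions and the `q`-binomial coefficient together cancel the zeros of
`1 + SinPi` at the points `q^{2s + 2m + 1} = 1`; away from these points this is an identity between
Pochhammer symbols. -/
lemma qProdSide_eq_qGammaSide_of_lt_one (h0 : 0 < q) (h1 : q < 1) {s : ℂ}
    (hs : ∀ m : ℕ, qBracket q (2 * s + 2 * m + 1) ≠ 0) : qProdSide q s = qGammaSide q s := by
  have h20 : 0 < q ^ 2 := by positivity
  have h21 : q ^ 2 < 1 := pow_lt_one₀ h0.le h1 two_ne_zero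
  have h40 : 0 < q ^ 4 := by positivity
  have h41 : q ^ 4 < 1 := pow_lt_one₀ h0.le h1 four_ne_zero
  have hq : (q : ℂ) ≠ 0 := by exact_mod_cast h0.ne'
  have hP := qPoch_self_ne_zero h0 h1 two_ne_zero two_ne_zero
  have hP1 : qPoch (q ^ 2) (q : ℂ) ≠ 0 := by
    simpa using qPoch_self_ne_zero h0 h1 two_ne_zero one_ne_zero
  have hP4 : qPoch (q ^ 4) ((q : ℂ) ^ 4) ≠ 0 :=
    qPoch_self_ne_zero h0 h1 four_ne_zero four_ne_zero
  have hE : qPoch (q ^ 2) ((q : ℂ) ^ (2 * s + 1)) ≠ 0 := by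
    refine qPoch_ne_zero h20 h21 fun m h => hs m ?_
    rw [qBracket, if_neg h1.ne, show 2 * s + 2 * (m : ℂ) + 1 = 2 * s + 1 + (2 : ℕ) * m by
      push_cast; ring, cpow_add_natCast_mul h0, h, zero_div]
  have e := qPoch_sq_mul h20 h21 ((q : ℂ) ^ (2 * s + 1))
  rw [show (q ^ 2) ^ 2 = q ^ 4 by ring, show (q : ℂ) ^ (2 * s + 1) * ((q ^ 2 : ℝ) : ℂ) =
    (q : ℂ) ^ (2 * s + 3) by
      rw [Complex.ofReal_pow, ← cpow_add_natCast h0]; push_cast; ring_nf] at e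
  rw [e] at hE
  obtain ⟨hE1, hE3⟩ := mul_ne_zero_iff.mp hE
  have hb : qBinom (q ^ 2) (s - 1 / 2) s = qPoch (q ^ 2) q * qPoch (q ^ 2) ((q : ℂ) ^ (2 * s + 2)) /
      (qPoch (q ^ 2) ((q : ℂ) ^ 2) * qPoch (q ^ 2) ((q : ℂ) ^ (2 * s + 1))) := by
    rw [qBinom_of_lt_one h20 h21, ofReal_pow_cpow h0, ofReal_pow_cpow h0, ofReal_pow_cpow h0]
    rw [show ((2 : ℕ) : ℂ) * (s - 1 / 2 - s + 1) = 1 by push_cast; ring, Complex.cpow_one]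
    push_cast
    ring_nf
  have hne4 := one_sub_ofReal_ne_zero h41
  have hc0 : (1 - ((q ^ 4 : ℝ) : ℂ)) ^ (-(1 / 2) : ℂ) ≠ 0 := by
    simp only [ne_eq, Complex.cpow_eq_zero_iff, hne4, false_and, not_false_eq_true]
  have hg : qGamma (q ^ 4) ((2 * s + 1) / 4) / qGamma (q ^ 4) ((2 * s + 3) / 4) =
      ((1 - ((q ^ 4 : ℝ) : ℂ)) ^ (-(1 / 2) : ℂ))⁻¹ *
        (qPoch (q ^ 4) ((q : ℂ) ^ (2 * s + 3)) / qPoch (q ^ 4) ((q : ℂ) ^ (2 * s + 1))) := by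
    have hc : (1 - ((q ^ 4 : ℝ) : ℂ)) ^ (-((2 * s + 3) / 4 - 1)) =
        (1 - ((q ^ 4 : ℝ) : ℂ)) ^ (-((2 * s + 1) / 4 - 1)) *
          (1 - ((q ^ 4 : ℝ) : ℂ)) ^ (-(1 / 2) : ℂ) := by
      rw [← Complex.cpow_add _ _ hne4]; ring_nf
    have hc1 : (1 - ((q ^ 4 : ℝ) : ℂ)) ^ (-((2 * s + 1) / 4 - 1)) ≠ 0 := by
      simp only [ne_eq, Complex.cpow_eq_zero_iff, hne4, false_and, not_false_eq_true]
    rw [qGamma, qGamma, qFactorial_of_lt_one h40 h41, qFactorial_of_lt_one h40 h41, hc,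
      ofReal_pow_cpow h0, ofReal_pow_cpow h0,
      show ((4 : ℕ) : ℂ) * ((2 * s + 1) / 4 - 1 + 1) = 2 * s + 1 by push_cast; ring,
      show ((4 : ℕ) : ℂ) * ((2 * s + 3) / 4 - 1 + 1) = 2 * s + 3 by push_cast; ring]
    have e4 : ((q ^ 4 : ℝ) : ℂ) = (q : ℂ) ^ 4 := by push_cast; rfl
    rw [← e4] at hP4
    generalize (1 - ((q ^ 4 : ℝ) : ℂ)) ^ (-((2 * s + 1) / 4 - 1)) = u at *
    generalize (1 - ((q ^ 4 : ℝ) : ℂ)) ^ (-(1 / 2) : ℂ) = v at *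
    generalize qPoch (q ^ 4) ((q : ℂ) ^ (2 * s + 3)) = E3 at *
    generalize qPoch (q ^ 4) ((q : ℂ) ^ (2 * s + 1)) = E1 at *
    field_simp
  rw [qGammaSide, hg, hb, qConstTwo_of_lt_one h0 h1, onePlusSinPi_of_lt_one h0 h1,
    qProdSide_of_lt_one h0 h1, e]
  generalize qPoch (q ^ 4) ((q : ℂ) ^ (2 * s + 3)) = E3 at *
  generalize qPoch (q ^ 4) ((q : ℂ) ^ (2 * s + 1)) = E1 at *
  field_simp

end LtOne

/-! ### Gamma function quotients as infinite products -/

lemma gamma_one_half : Complex.Gamma (1 / 2) = (Real.sqrt Real.pi : ℂ) := by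
  rw [← Real.Gamma_one_half_eq, ← Complex.Gamma_ofReal]
  push_cast
  rfl

lemma natCast_add_ne_zero_of_re_pos {c : ℂ} (hc : 0 < c.re) (n : ℕ) : (n : ℂ) + c ≠ 0 := by
  intro h
  have := congrArg Complex.re h
  simp at this
  linarith [(Nat.cast_nonneg n : (0 : ℝ) ≤ n)]

lemma add_re_le_norm_natCast_add (c : ℂ) (n : ℕ) : (n : ℝ) + c.re ≤ ‖(n : ℂ) + c‖ := by
  simpa using Complex.re_le_norm ((n : ℂ) + c)

lemma summable_one_div_add_sq (e : ℝ) : Summable fun n : ℕ => 1 / ((n : ℝ) + e) ^ 2 := by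
  have := (Real.summable_one_div_nat_add_rpow e 2).mpr one_lt_two
  simpa using this

/-- A factor of a balanced quotient differs from `1` by an expression of second order, since
`A B = C D` implies `C + D - A - B = (C - A) (C - B) / C`. -/
lemma one_sub_mul_div_mul_eq {A B C D : ℂ} (hC : C ≠ 0) (hAB : A * B = C * D) (x : ℂ)
    (h1 : 1 - x * C ≠ 0) (h2 : 1 - x * D ≠ 0) :
    (1 - x * A) * (1 - x * B) / ((1 - x * C) * (1 - x * D)) - 1 =
      x * (C - A) * (C - B) / (C * ((1 - x * C) * (1 - x * D))) := by
  field_simp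
  linear_combination (x * C * x - x) * hAB

lemma multipliable_gamma_quotient {a b c d : ℂ} (hc : 0 < c.re) (hd : 0 < d.re)
    (h : a + b = c + d) :
    Multipliable fun n : ℕ => ((n + a) * (n + b)) / ((n + c) * (n + d)) := by
  set e := min c.re d.re
  have he0 : 0 < e := lt_min hc hd
  have key : ∀ n : ℕ, ((n + a) * (n + b)) / ((n + c) * (n + d)) =
      1 + (a * b - c * d) / ((n + c) * (n + d)) := by
    intro n
    have h1 := natCast_add_ne_zero_of_re_pos hc n
    have h2 := natCast_add_ne_zero_of_re_pos hd n
    field_simp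
    linear_combination (n : ℂ) * h
  refine (multipliable_one_add_of_summable (f := fun n : ℕ => (a * b - c * d) / ((n + c) * (n + d)))
    (((summable_one_div_add_sq e).mul_left ‖a * b - c * d‖).of_nonneg_of_le
      (fun n => norm_nonneg _) fun n => ?_)).congr fun n => (key n).symm
  have hn : (0 : ℝ) ≤ n := Nat.cast_nonneg n
  have h1 : (n : ℝ) + e ≤ ‖(n : ℂ) + c‖ :=
    (add_le_add_right (min_le_left _ _) _).trans (add_re_le_norm_natCast_add c n)
  have h2 : (n : ℝ) + e ≤ ‖(n : ℂ) + d‖ :=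
    (add_le_add_right (min_le_right _ _) _).trans (add_re_le_norm_natCast_add d n)
  rw [norm_div, norm_mul, div_eq_mul_one_div, pow_two]
  gcongr

/-- If `a` or `b` is a pole of `Γ`, both the product and, by the convention for `Γ` at its poles,
the quotient vanish. -/
lemma hasProd_gamma_quotient {a b c d : ℂ} (hc : 0 < c.re) (hd : 0 < d.re) (h : a + b = c + d) :
    HasProd (fun n : ℕ => ((n + a) * (n + b)) / ((n + c) * (n + d)))
      (Complex.Gamma c * Complex.Gamma d / (Complex.Gamma a * Complex.Gamma b)) := by
  by_cases ha : ∃ m : ℕ, a = -m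
  · obtain ⟨m, rfl⟩ := ha
    rw [Complex.Gamma_neg_nat_eq_zero, zero_mul, div_zero]
    exact hasProd_zero_of_exists_eq_zero ⟨m, by simp⟩
  by_cases hb : ∃ m : ℕ, b = -m
  · obtain ⟨m, rfl⟩ := hb
    rw [Complex.Gamma_neg_nat_eq_zero, mul_zero, div_zero]
    exact hasProd_zero_of_exists_eq_zero ⟨m, by simp⟩
  push Not at ha hb
  rw [(multipliable_gamma_quotient hc hd h).hasProd_iff_tendsto_nat]
  have hl := ((Complex.GammaSeq_tendsto_Gamma c).mul (Complex.GammaSeq_tendsto_Gamma d)).div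
    ((Complex.GammaSeq_tendsto_Gamma a).mul (Complex.GammaSeq_tendsto_Gamma b))
    (mul_ne_zero (Complex.Gamma_ne_zero ha) (Complex.Gamma_ne_zero hb))
  rw [← tendsto_add_atTop_iff_nat 1]
  refine hl.congr' ?_
  filter_upwards [eventually_ne_atTop 0] with N hN
  have hN' : (N : ℂ) ≠ 0 := by exact_mod_cast hN
  -- The powers of `N` in Euler's limit formula cancel because `a + b = c + d`.
  have hpow : (N : ℂ) ^ c * (N : ℂ) ^ d = (N : ℂ) ^ a * (N : ℂ) ^ b := by
    rw [← Complex.cpow_add _ _ hN', ← Complex.cpow_add _ _ hN', h]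
  have hne : ∀ z : ℂ, (N : ℂ) ^ z ≠ 0 := fun z => by simp [Complex.cpow_eq_zero_iff, hN']
  have hf : (N.factorial : ℂ) ≠ 0 := by exact_mod_cast N.factorial_ne_zero
  have hprod : ∀ z : ℂ, (∀ m : ℕ, z ≠ -m) → ∏ j ∈ Finset.range (N + 1), (z + j) ≠ 0 :=
    fun z hz => Finset.prod_ne_zero_iff.mpr fun j _ h0 => hz j (eq_neg_of_add_eq_zero_left h0)
  have pa := hprod a ha
  have pb := hprod b hb
  have pc := hprod c fun m hm => natCast_add_ne_zero_of_re_pos hc m (by rw [hm]; ring)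
  have pd := hprod d fun m hm => natCast_add_ne_zero_of_re_pos hd m (by rw [hm]; ring)
  simp only [Pi.div_apply, Complex.GammaSeq]
  rw [Finset.prod_div_distrib, Finset.prod_mul_distrib, Finset.prod_mul_distrib]
  simp_rw [add_comm (_ : ℂ) a, add_comm (_ : ℂ) b, add_comm (_ : ℂ) c, add_comm (_ : ℂ) d]
  have e1 : ∀ x y u v w : ℂ, x * w / u * (y * w / v) = (x * y) * w ^ 2 / (u * v) :=
    fun x y u v w => by ring
  rw [e1, e1, hpow]
  have := mul_ne_zero (hne a) (hne b)
  field_simp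
  exact div_self this

/-! ### Bailey's summation formula at `1/2` -/

/-- The coefficient `(1/2)_n² / (n! 2^n)`. -/
noncomputable def baileyCoeff (n : ℕ) : ℂ :=
  ∏ k ∈ Finset.range n, ((k : ℂ) + 1 / 2) ^ 2 / (2 * (k + 1))

/-- The terms of `₂F₁(1/2, 1/2; c; 1/2) / Γ(c)`, a series which is entire in `c`. -/
noncomputable def baileyTerm (c : ℂ) (n : ℕ) : ℂ := baileyCoeff n * (Complex.Gamma (c + n))⁻¹

lemma baileyCoeff_succ (n : ℕ) :
    2 * ((n : ℂ) + 1) * baileyCoeff (n + 1) = ((n : ℂ) + 1 / 2) ^ 2 * baileyCoeff n := by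
  have : (n : ℂ) + 1 ≠ 0 := Nat.cast_add_one_ne_zero n
  rw [baileyCoeff, Finset.prod_range_succ, ← baileyCoeff]
  field_simp

lemma baileyTerm_succ (c : ℂ) (n : ℕ) :
    2 * ((n : ℂ) + 1) * (c + n) * baileyTerm c (n + 1) =
      ((n : ℂ) + 1 / 2) ^ 2 * baileyTerm c n := by
  have h := Complex.one_div_Gamma_eq_self_mul_one_div_Gamma_add_one (c + n)
  rw [baileyTerm, baileyTerm, h]
  push_cast
  rw [← add_assoc]
  linear_combination (c + n) * (Complex.Gamma (c + n + 1))⁻¹ * baileyCoeff_succ n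

lemma tendsto_natCast_add_div (x y : ℂ) :
    Tendsto (fun n : ℕ => ((n : ℂ) + x) / (n + y)) atTop (𝓝 1) := by
  have h (x : ℂ) : Tendsto (fun n : ℕ => 1 + x / (n : ℂ)) atTop (𝓝 1) := by
    simpa using (tendsto_const_div_atTop_nhds_zero_nat x).const_add 1
  have h2 := (h x).div (h y) one_ne_zero
  rw [div_one] at h2
  refine h2.congr' ?_
  filter_upwards [eventually_ne_atTop 0] with n hn
  have hn' : (n : ℂ) ≠ 0 := by exact_mod_cast hn
  rw [Pi.div_apply, ← mul_div_mul_left _ _ hn', mul_add, mul_add, mul_one, mul_div_cancel₀ _ hn',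
    mul_div_cancel₀ _ hn']

lemma eventually_natCast_add_ne_zero (c : ℂ) : ∀ᶠ n : ℕ in atTop, (n : ℂ) + c ≠ 0 := by
  filter_upwards [eventually_gt_atTop ⌈‖c‖⌉₊] with n hn h
  have h1 : ‖(n : ℂ)‖ = ‖c‖ := by rw [eq_neg_of_add_eq_zero_left h, norm_neg]
  rw [Complex.norm_natCast] at h1
  exact absurd (Nat.lt_of_ceil_lt hn) (by rw [h1]; exact lt_irrefl _)

lemma summable_baileyTerm (c : ℂ) : Summable (baileyTerm c) := by
  have hlim : Tendsto (fun n : ℕ => ‖(1 / 2 : ℂ) * ((((n : ℂ) + 1 / 2) / (n + 1)) *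
      (((n : ℂ) + 1 / 2) / (n + c)))‖) atTop (𝓝 (1 / 2)) := by
    simpa using (((tendsto_natCast_add_div (1 / 2) 1).mul
      (tendsto_natCast_add_div (1 / 2) c)).const_mul (1 / 2 : ℂ)).norm
  refine summable_of_ratio_norm_eventually_le (r := 3 / 4) (by norm_num) ?_
  filter_upwards [hlim.eventually_le_const (by norm_num : (1 / 2 : ℝ) < 3 / 4),
    eventually_natCast_add_ne_zero c] with n hn hc
  have h1 : (n : ℂ) + 1 ≠ 0 := Nat.cast_add_one_ne_zero n
  have e : baileyTerm c (n + 1) = (1 / 2 : ℂ) * ((((n : ℂ) + 1 / 2) / (n + 1)) *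
      (((n : ℂ) + 1 / 2) / (n + c))) * baileyTerm c n := by
    have := baileyTerm_succ c n
    rw [add_comm c] at this
    field_simp at this ⊢
    linear_combination this
  rw [e, norm_mul]
  exact mul_le_mul_of_nonneg_right hn (norm_nonneg _)

/-- The functional equation of the series. As in the `q`-case the difference of the two sides
telescopes, now with the certificate `-2n / (c + n)` times the `n`-th term. -/
lemma tsum_baileyTerm_eq (c : ℂ) :
    ∑' n, baileyTerm c n = (c + 1 / 2) ^ 2 * ∑' n, baileyTerm (c + 2) n := by
  set g : ℕ → ℂ := fun n => -(2 * n * baileyCoeff n * (Complex.Gamma (c + n + 1))⁻¹) with hg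
  have hstep : ∀ n, baileyTerm c n - (c + 1 / 2) ^ 2 * baileyTerm (c + 2) n = g (n + 1) - g n := by
    intro n
    have h1 := Complex.one_div_Gamma_eq_self_mul_one_div_Gamma_add_one (c + n)
    have h2 := Complex.one_div_Gamma_eq_self_mul_one_div_Gamma_add_one (c + n + 1)
    simp only [baileyTerm, hg]
    rw [h1, h2, show c + 2 + n = c + n + 1 + 1 by ring]
    push_cast
    rw [← add_assoc c]
    linear_combination (Complex.Gamma (c + n + 1 + 1))⁻¹ * baileyCoeff_succ n
  have hs1 := summable_baileyTerm c
  have hs2 := (summable_baileyTerm (c + 2)).mul_left ((c + 1 / 2) ^ 2)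
  have hg0 : Tendsto g atTop (𝓝 0) := by
    have hl := ((tendsto_natCast_add_div 0 c).mul hs1.tendsto_atTop_zero).const_mul (-2 : ℂ)
    rw [mul_zero, mul_zero] at hl
    refine hl.congr' ?_
    filter_upwards [eventually_natCast_add_ne_zero c] with n hn
    have h1 := Complex.one_div_Gamma_eq_self_mul_one_div_Gamma_add_one (c + n)
    simp only [hg, baileyTerm]
    rw [h1, add_zero, add_comm c (n : ℂ)]
    field_simp
  have h5 := (hs1.sub hs2).hasSum.tendsto_sum_nat
  have h6 : Tendsto (fun N => ∑ n ∈ Finset.range N,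
      (baileyTerm c n - (c + 1 / 2) ^ 2 * baileyTerm (c + 2) n)) atTop (𝓝 0) := by
    have e : ∀ N, ∑ n ∈ Finset.range N,
        (baileyTerm c n - (c + 1 / 2) ^ 2 * baileyTerm (c + 2) n) = g N := fun N => by
      rw [Finset.sum_congr rfl fun n _ => hstep n, Finset.sum_range_sub]
      simp [hg]
    simpa only [e] using hg0
  have h7 := tendsto_nhds_unique h5 h6
  rw [hs1.tsum_sub hs2, tsum_mul_left] at h7
  exact sub_eq_zero.mp h7

lemma baileyTerm_mul_Gamma {z : ℂ} (hz : 0 < z.re) (n : ℕ) :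
    baileyTerm z n * Complex.Gamma z =
      ∏ k ∈ Finset.range n, ((k : ℂ) + 1 / 2) ^ 2 / (2 * (k + 1) * (k + z)) := by
  induction n with
  | zero =>
    have : Complex.Gamma z ≠ 0 := Complex.Gamma_ne_zero_of_re_pos hz
    simp [baileyTerm, baileyCoeff, this]
  | succ n ih =>
    have h1 : (n : ℂ) + 1 ≠ 0 := Nat.cast_add_one_ne_zero n
    have h2 := natCast_add_ne_zero_of_re_pos hz n
    rw [Finset.prod_range_succ, ← ih]
    have h := baileyTerm_succ z n
    rw [add_comm z] at h
    rw [mul_div_assoc', eq_div_iff (by simp [h1, h2])]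
    linear_combination Complex.Gamma z * h

lemma tendsto_tsum_baileyTerm_mul_Gamma {c : ℂ} (hc : 0 < c.re) :
    Tendsto (fun N : ℕ => (∑' n, baileyTerm (c + 2 * N) n) * Complex.Gamma (c + 2 * N))
      atTop (𝓝 1) := by
  have hre : ∀ N : ℕ, (c + 2 * N).re = c.re + 2 * N := fun N => by simp
  have hpos : ∀ N : ℕ, 0 < (c + 2 * N).re := fun N => by
    rw [hre]; positivity
  have h := tendsto_tsum_of_dominated_convergence (𝓕 := atTop)
    (f := fun (N n : ℕ) => baileyTerm (c + 2 * N) n * Complex.Gamma (c + 2 * N))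
    (g := fun n => if n = 0 then 1 else 0) (bound := fun n => (1 / 2 : ℝ) ^ n)
    (summable_geometric_of_lt_one (by norm_num) (by norm_num)) (fun n => ?_) ?_
  · simpa [tsum_mul_right] using h
  · simp_rw [baileyTerm_mul_Gamma (hpos _)]
    rcases Nat.eq_zero_or_pos n with rfl | hn
    · simp
    rw [if_neg hn.ne']
    have hk : ∀ k : ℕ, Tendsto (fun N : ℕ => ((k : ℂ) + 1 / 2) ^ 2 /
        (2 * (k + 1) * (k + (c + 2 * N)))) atTop (𝓝 0) := by
      intro k
      have h1 : Tendsto (fun N : ℕ => ((N : ℂ) + (k + c) / 2)⁻¹) atTop (𝓝 0) := by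
        refine tendsto_inv₀_cobounded.comp ?_
        rw [← tendsto_norm_atTop_iff_cobounded]
        refine tendsto_atTop_mono (fun N => add_re_le_norm_natCast_add _ N) ?_
        exact tendsto_atTop_add_const_right _ _ tendsto_natCast_atTop_atTop
      have h2 := h1.const_mul (((k : ℂ) + 1 / 2) ^ 2 / (2 * (k + 1) * 2))
      rw [mul_zero] at h2
      refine h2.congr fun N => ?_
      rw [show (2 : ℂ) * (k + 1) * (k + (c + 2 * N)) = 2 * (k + 1) * 2 * (N + (k + c) / 2) by ring]
      simp only [div_eq_mul_inv, mul_inv]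
      ring
    have h3 := tendsto_finsetProd (Finset.range n) fun k _ => hk k
    simpa [hn.ne'] using h3
  -- For `N ≥ 1` one has `(k + 1/2)² ≤ (k + 1) |k + c + 2N|`, so that each factor of the `n`-th term
  -- is at most `1/2` in absolute value.
  · filter_upwards [eventually_ge_atTop 1] with N hN n
    rw [baileyTerm_mul_Gamma (hpos _), norm_prod, ← Finset.card_range n, ← Finset.prod_const,
      Finset.card_range]
    refine Finset.prod_le_prod (fun _ _ => norm_nonneg _) fun k _ => ?_
    have h1 : (k : ℝ) + 1 ≤ ‖(k : ℂ) + (c + 2 * N)‖ := by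
      refine le_trans ?_ (add_re_le_norm_natCast_add _ k)
      rw [hre]
      have : (1 : ℝ) ≤ N := by exact_mod_cast hN
      linarith
    have h2 : ‖(k : ℂ) + 1 / 2‖ = k + 1 / 2 := by
      rw [show (k : ℂ) + 1 / 2 = ((k + 1 / 2 : ℝ) : ℂ) by push_cast; rfl, Complex.norm_real,
        Real.norm_of_nonneg (by positivity)]
    have h3 : ‖(k : ℂ) + 1‖ = k + 1 := by exact_mod_cast Complex.norm_natCast (k + 1)
    have hk0 : (0 : ℝ) ≤ k := Nat.cast_nonneg k
    have h4 : 0 < ‖(k : ℂ) + (c + 2 * N)‖ := by linarith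
    rw [norm_div, norm_pow, norm_mul, norm_mul, h2, h3, Complex.norm_ofNat,
      div_le_iff₀ (by positivity)]
    nlinarith [mul_le_mul_of_nonneg_left h1 (by positivity : (0 : ℝ) ≤ k + 1)]

/-- Bailey's summation formula `₂F₁(1/2, 1/2; c; 1/2) / Γ(c) = 2^{1 - c} √π / Γ(c/2 + 1/4)²`. For
`0 < re c` it results from iterating the functional equation, which then carries it to all `c`. -/
theorem tsum_baileyTerm (c : ℂ) :
    ∑' n, baileyTerm c n =
      (2 : ℂ) ^ (1 - c) * (Real.sqrt Real.pi : ℂ) / Complex.Gamma (c / 2 + 1 / 4) ^ 2 := by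
  have hpos : ∀ c : ℂ, 0 < c.re → ∑' n, baileyTerm c n =
      (2 : ℂ) ^ (1 - c) * (Real.sqrt Real.pi : ℂ) / Complex.Gamma (c / 2 + 1 / 4) ^ 2 := by
    intro c hc
    have hΓ : Complex.Gamma c ≠ 0 := Complex.Gamma_ne_zero_of_re_pos hc
    have hiter : ∀ N : ℕ, (∑' n, baileyTerm c n) * Complex.Gamma c =
        (∏ k ∈ Finset.range N, ((k + (c / 2 + 1 / 4)) * (k + (c / 2 + 1 / 4))) /
          ((k + c / 2) * (k + (c / 2 + 1 / 2)))) *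
        ((∑' n, baileyTerm (c + 2 * N) n) * Complex.Gamma (c + 2 * N)) := by
      intro N
      induction N with
      | zero => simp
      | succ N ih =>
        have n1 : (N : ℂ) + c / 2 ≠ 0 := natCast_add_ne_zero_of_re_pos (by simpa using hc) N
        have n2 : (N : ℂ) + (c / 2 + 1 / 2) ≠ 0 :=
          natCast_add_ne_zero_of_re_pos (by simp; linarith) N
        have m1 : c + 2 * N ≠ 0 := fun h => n1 (by linear_combination h / 2)
        have m2 : c + 2 * N + 1 ≠ 0 := fun h => n2 (by linear_combination h / 2)
        rw [ih, Finset.prod_range_succ, tsum_baileyTerm_eq, Nat.cast_succ,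
          show c + 2 * ((N : ℂ) + 1) = c + 2 * N + 1 + 1 by ring,
          Complex.Gamma_add_one _ m2, Complex.Gamma_add_one _ m1,
          show c + 2 * (N : ℂ) + 1 + 1 = c + 2 * N + 2 by ring]
        have e : (c + 2 * N + 1 / 2) ^ 2 = ((N + (c / 2 + 1 / 4)) * (N + (c / 2 + 1 / 4))) /
            ((N + c / 2) * (N + (c / 2 + 1 / 2))) * ((c + 2 * N + 1) * (c + 2 * N)) := by
          rw [div_mul_eq_mul_div, eq_div_iff (mul_ne_zero n1 n2)]
          ring
        rw [e]
        generalize ((N + (c / 2 + 1 / 4)) * (N + (c / 2 + 1 / 4))) /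
            ((N + c / 2) * (N + (c / 2 + 1 / 2))) = u
        ring
    have hl := (hasProd_gamma_quotient (a := c / 2 + 1 / 4) (b := c / 2 + 1 / 4) (c := c / 2)
      (d := c / 2 + 1 / 2) (by simpa using hc) (by simp; linarith) (by ring)).tendsto_prod_nat.mul
      (tendsto_tsum_baileyTerm_mul_Gamma hc)
    have h := tendsto_nhds_unique
      (tendsto_const_nhds (x := (∑' n, baileyTerm c n) * Complex.Gamma c))
      (hl.congr fun N => (hiter N).symm)
    -- Legendre's duplication formula turns `Γ(c/2) Γ(c/2 + 1/2)` into a multiple of `Γ(c)`.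
    rw [mul_one, Complex.Gamma_mul_Gamma_add_half, show 2 * (c / 2) = c by ring] at h
    apply mul_right_cancel₀ hΓ
    rw [h]
    ring
  have hind : ∀ N : ℕ, ∀ c : ℂ, -(2 * N : ℝ) < c.re → ∑' n, baileyTerm c n =
      (2 : ℂ) ^ (1 - c) * (Real.sqrt Real.pi : ℂ) / Complex.Gamma (c / 2 + 1 / 4) ^ 2 := by
    intro N
    induction N with
    | zero => exact fun c hc => hpos c (by simpa using hc)
    | succ N ih =>
      intro c hc
      have h := Complex.one_div_Gamma_eq_self_mul_one_div_Gamma_add_one (c / 2 + 1 / 4)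
      have h2 : (2 : ℂ) ^ (1 - c) = 4 * (2 : ℂ) ^ (1 - (c + 2)) := by
        rw [show (1 : ℂ) - c = (2 : ℕ) + (1 - (c + 2)) by push_cast; ring,
          Complex.cpow_add _ _ two_ne_zero, Complex.cpow_natCast]
        norm_num
      have h3 : (Complex.Gamma (c / 2 + 1 / 4) ^ 2)⁻¹ =
          (c / 2 + 1 / 4) ^ 2 * (Complex.Gamma (c / 2 + 1 / 4 + 1) ^ 2)⁻¹ := by
        rw [← inv_pow, h, mul_pow, inv_pow]
      rw [tsum_baileyTerm_eq, ih (c + 2) (by push_cast at hc; simp; linarith), h2,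
        show (c + 2) / 2 + 1 / 4 = c / 2 + 1 / 4 + 1 by ring,
        div_eq_mul_inv _ (Complex.Gamma (c / 2 + 1 / 4) ^ 2), h3,
        div_eq_mul_inv _ (Complex.Gamma (c / 2 + 1 / 4 + 1) ^ 2)]
      ring
  obtain ⟨N, hN⟩ := exists_nat_gt (-c.re)
  exact hind N c (by linarith [(Nat.cast_nonneg N : (0 : ℝ) ≤ N)])

/-! ### The identities at `q = 1` -/

/-- The closed form of the product side at `q = 1`. -/
noncomputable def qProdOne (s : ℂ) : ℂ :=
  (2 : ℂ) ^ s * (Real.sqrt Real.pi : ℂ) /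
    (Complex.Gamma (s + 1) * Complex.Gamma (3 / 4 - s / 2) ^ 2)

lemma qBinom_one (α β : ℂ) : qBinom (1 ^ 2) α β =
    Complex.Gamma (α + 1) / (Complex.Gamma (α - β + 1) * Complex.Gamma (β + 1)) := by
  simp [qBinom, qFactorial]

lemma qSumTerm_one_coeff (n : ℕ) :
    Complex.Gamma (n + 1) *
      (∏ j ∈ Finset.Icc 1 n, qBracket 1 (2 * j - 1) / qBracket 1 (2 * j)) ^ 2 *
      (1 / ∏ j ∈ Finset.Icc 1 n, (1 + ((1 : ℝ) : ℂ) ^ (2 * j))) = baileyCoeff n := by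
  induction n with
  | zero => simp [baileyCoeff]
  | succ n ih =>
    have h1 : (n : ℂ) + 1 ≠ 0 := Nat.cast_add_one_ne_zero n
    rw [Finset.prod_Icc_succ_top (by omega), Finset.prod_Icc_succ_top (by omega), baileyCoeff,
      Finset.prod_range_succ, ← baileyCoeff, ← ih, Nat.cast_succ, Complex.Gamma_add_one _ h1,
      mul_pow, ← one_div_mul_one_div]
    have e : qBracket 1 (2 * ((n : ℂ) + 1) - 1) / qBracket 1 (2 * ((n : ℂ) + 1)) =
        (n + 1 / 2) / (n + 1) := by
      simp only [qBracket, if_true]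
      field_simp
      ring
    rw [e, Complex.ofReal_one, one_pow, div_pow]
    have e2 : ((n : ℂ) + 1 / 2) ^ 2 / (2 * (n + 1)) =
        (n + 1) * ((n + 1 / 2) ^ 2 / (n + 1) ^ 2) * (1 / (1 + 1)) := by
      field_simp
      ring
    rw [e2]
    ring

lemma qSumTerm_one (s : ℂ) (n : ℕ) :
    qSumTerm 1 s n = (Complex.Gamma (s + 1))⁻¹ * baileyTerm (1 - s) n := by
  rw [qSumTerm, qBinom_one, baileyTerm, ← qSumTerm_one_coeff, Complex.ofReal_one, Complex.one_cpow,
    show (n : ℂ) - s + 1 = 1 - s + n by ring, div_eq_mul_inv (Complex.Gamma (n + 1)), mul_inv]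
  ring

lemma hasSum_qSumTerm_one (s : ℂ) : HasSum (qSumTerm 1 s) (qProdOne s) := by
  rw [funext (qSumTerm_one s)]
  have h := (summable_baileyTerm (1 - s)).hasSum.mul_left (Complex.Gamma (s + 1))⁻¹
  rw [tsum_baileyTerm, show 1 - (1 - s) = s by ring,
    show (1 - s) / 2 + 1 / 4 = 3 / 4 - s / 2 by ring] at h
  rw [qProdOne, div_eq_mul_inv, mul_inv]
  rw [div_eq_mul_inv] at h
  refine Eq.subst (motive := fun x => HasSum _ x) ?_ h
  ring

lemma gamma_quotients_eq_qProdOne (s : ℂ) :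
    Complex.Gamma (1 / 2) * Complex.Gamma (3 / 4) /
        (Complex.Gamma (3 / 4 - s / 2) * Complex.Gamma (1 / 2 + s / 2)) *
      (Complex.Gamma 1 * Complex.Gamma (3 / 4) /
        (Complex.Gamma (3 / 4 - s / 2) * Complex.Gamma (1 + s / 2))) *
      (Complex.Gamma (1 / 2) * Complex.Gamma 1 / (Complex.Gamma (3 / 4) * Complex.Gamma (3 / 4))) =
    qProdOne s := by
  have hd := Complex.Gamma_mul_Gamma_add_half (1 / 2 + s / 2)
  rw [show (1 / 2 : ℂ) + s / 2 + 1 / 2 = 1 + s / 2 by ring,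
    show 2 * (1 / 2 + s / 2) = s + 1 by ring, show 1 - (s + 1) = -s by ring, Complex.cpow_neg] at hd
  have h34 : Complex.Gamma (3 / 4) ≠ 0 := Complex.Gamma_ne_zero_of_re_pos (by norm_num)
  have hπ : (Real.sqrt Real.pi : ℂ) ≠ 0 := by
    exact_mod_cast (Real.sqrt_pos.mpr Real.pi_pos).ne'
  have h2 : (2 : ℂ) ^ s ≠ 0 := by simp [Complex.cpow_eq_zero_iff]
  rw [Complex.Gamma_one, gamma_one_half, qProdOne]
  calc _ = (Real.sqrt Real.pi : ℂ) ^ 2 / (Complex.Gamma (3 / 4 - s / 2) ^ 2 *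
        (Complex.Gamma (1 / 2 + s / 2) * Complex.Gamma (1 + s / 2))) := by field_simp
    _ = _ := by
      rw [hd]
      field_simp

lemma hasProd_qProdOne (s : ℂ) :
    HasProd (fun n : ℕ => ((4 * n + 3 - 2 * s) ^ 2 * (4 * n + 2 + 2 * s) * (4 * n + 4 + 2 * s)) /
        ((4 * (n : ℂ) + 2) ^ 2 * (4 * (n : ℂ) + 4) ^ 2)) (qProdOne s) := by
  have h1 := hasProd_gamma_quotient (a := 3 / 4 - s / 2) (b := 1 / 2 + s / 2) (c := 1 / 2)
    (d := 3 / 4) (by norm_num) (by norm_num) (by ring)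
  have h2 := hasProd_gamma_quotient (a := 3 / 4 - s / 2) (b := 1 + s / 2) (c := 1)
    (d := 3 / 4) (by norm_num) (by norm_num) (by ring)
  have h3 := hasProd_gamma_quotient (a := 3 / 4) (b := 3 / 4) (c := 1 / 2)
    (d := 1) (by norm_num) (by norm_num) (by ring)
  rw [← gamma_quotients_eq_qProdOne]
  refine ((h1.mul h2).mul h3).congr_fun fun n => ?_
  have n1 : (n : ℂ) + 1 / 2 ≠ 0 := natCast_add_ne_zero_of_re_pos (by norm_num) n
  have n2 : (n : ℂ) + 1 ≠ 0 := natCast_add_ne_zero_of_re_pos (by norm_num) n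
  have n3 : (n : ℂ) + 3 / 4 ≠ 0 := natCast_add_ne_zero_of_re_pos (by norm_num) n
  rw [show 4 * (n : ℂ) + 2 = 4 * (n + 1 / 2) by ring, show 4 * (n : ℂ) + 4 = 4 * (n + 1) by ring,
    show 4 * (n : ℂ) + 3 - 2 * s = 4 * (n + (3 / 4 - s / 2)) by ring,
    show 4 * ((n : ℂ) + 1 / 2) + 2 * s = 4 * (n + (1 / 2 + s / 2)) by ring,
    show 4 * ((n : ℂ) + 1) + 2 * s = 4 * (n + (1 + s / 2)) by ring]
  generalize (n : ℂ) + (3 / 4 - s / 2) = x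
  generalize (n : ℂ) + (1 / 2 + s / 2) = y
  generalize (n : ℂ) + (1 + s / 2) = z
  generalize (n : ℂ) + 1 / 2 = u at *
  generalize (n : ℂ) + 1 = v at *
  generalize (n : ℂ) + 3 / 4 = w at *
  field_simp

lemma continuous_qProdOne : Continuous qProdOne := by
  have hΓ := Complex.differentiable_one_div_Gamma.continuous
  have h2 : Continuous fun s : ℂ => (2 : ℂ) ^ s := continuous_id.const_cpow (Or.inl two_ne_zero)
  have e : qProdOne = fun s => (2 : ℂ) ^ s * (Real.sqrt Real.pi : ℂ) *
      ((Complex.Gamma (s + 1))⁻¹ * (Complex.Gamma (3 / 4 - s / 2))⁻¹ ^ 2) := by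
    funext s
    rw [qProdOne, div_eq_mul_inv, mul_inv, inv_pow]
  rw [e]
  exact (h2.mul continuous_const).mul ((hΓ.comp (by fun_prop)).mul ((hΓ.comp (by fun_prop)).pow 2))

lemma sin_sq_shift (s : ℂ) :
    2 * Complex.sin (Real.pi * (s / 2 + 1 / 4)) ^ 2 = 1 + Complex.sin (Real.pi * s) := by
  have h := Complex.cos_two_mul (Real.pi * (s / 2 + 1 / 4))
  rw [show 2 * (Real.pi * (s / 2 + 1 / 4)) = Real.pi * s + Real.pi / 2 by ring,
    Complex.cos_add_pi_div_two] at h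
  linear_combination 2 * Complex.sin_sq_add_cos_sq (Real.pi * (s / 2 + 1 / 4)) + h

lemma onePlusSinPi_one (s : ℂ) : onePlusSinPi 1 s = 1 + Complex.sin (Real.pi * s) := by
  have h := hasProd_gamma_quotient (a := 1 - (s / 2 + 1 / 4)) (b := s / 2 + 1 / 4) (c := 3 / 4)
    (d := 1 / 4) (by norm_num) (by norm_num) (by ring)
  have e0 : Complex.Gamma (3 / 4) * Complex.Gamma (1 / 4) = Real.pi * (Real.sqrt 2 : ℂ) := by
    have h4 := Complex.Gamma_mul_Gamma_one_sub (1 / 4)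
    rw [show (1 : ℂ) - 1 / 4 = 3 / 4 by ring, mul_comm] at h4
    rw [h4, show (Real.pi : ℂ) * (1 / 4) = ((Real.pi / 4 : ℝ) : ℂ) by push_cast; ring,
      ← Complex.ofReal_sin, Real.sin_pi_div_four]
    have : (Real.sqrt 2 : ℂ) ^ 2 = 2 := by exact_mod_cast Real.sq_sqrt (by norm_num : (0 : ℝ) ≤ 2)
    have h0 : (Real.sqrt 2 : ℂ) ≠ 0 := fun h => by simp [h] at this
    push_cast
    field_simp
    linear_combination -this
  have hπ : (Real.pi : ℂ) ≠ 0 := by exact_mod_cast Real.pi_ne_zero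
  have e1 : Complex.Gamma (3 / 4) * Complex.Gamma (1 / 4) /
      (Complex.Gamma (1 - (s / 2 + 1 / 4)) * Complex.Gamma (s / 2 + 1 / 4)) =
      (Real.sqrt 2 : ℂ) * Complex.sin (Real.pi * (s / 2 + 1 / 4)) := by
    rw [e0, mul_comm (Complex.Gamma (1 - _)), Complex.Gamma_mul_Gamma_one_sub, div_div_eq_mul_div]
    field_simp
  rw [e1] at h
  have h2 := h.mul h
  have e2 : (Real.sqrt 2 : ℂ) * Complex.sin (Real.pi * (s / 2 + 1 / 4)) *
      ((Real.sqrt 2 : ℂ) * Complex.sin (Real.pi * (s / 2 + 1 / 4))) =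
      1 + Complex.sin (Real.pi * s) := by
    rw [← sin_sq_shift]
    have : (Real.sqrt 2 : ℂ) ^ 2 = 2 := by exact_mod_cast Real.sq_sqrt (by norm_num : (0 : ℝ) ≤ 2)
    linear_combination (Complex.sin (Real.pi * (s / 2 + 1 / 4))) ^ 2 * this
  rw [e2] at h2
  rw [onePlusSinPi, Complex.ofReal_one, Complex.one_cpow, one_mul, ← h2.tprod_eq]
  refine tprod_congr fun n => ?_
  have n1 : (n : ℂ) + 1 / 4 ≠ 0 := natCast_add_ne_zero_of_re_pos (by norm_num) n
  have n3 : (n : ℂ) + 3 / 4 ≠ 0 := natCast_add_ne_zero_of_re_pos (by norm_num) n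
  simp only [qBracket, if_true]
  rw [show 4 * (n : ℂ) + 3 - 2 * s = 4 * (n + (1 - (s / 2 + 1 / 4))) by ring,
    show 4 * (n : ℂ) + 1 + 2 * s = 4 * (n + (s / 2 + 1 / 4)) by ring,
    show 4 * (n : ℂ) + 3 = 4 * (n + 3 / 4) by ring, show 4 * (n : ℂ) + 1 = 4 * (n + 1 / 4) by ring]
  generalize (n : ℂ) + (1 - (s / 2 + 1 / 4)) = x
  generalize (n : ℂ) + (s / 2 + 1 / 4) = y
  generalize (n : ℂ) + 1 / 4 = u at *
  generalize (n : ℂ) + 3 / 4 = v at *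
  field_simp

lemma qProdOne_eq_qGammaSide (hC : qConstTwo 1 = 1 / Real.sqrt (2 * Real.pi)) {s : ℂ}
    (hs : ∀ m : ℕ, qBracket 1 (2 * s + 2 * m + 1) ≠ 0) : qProdOne s = qGammaSide 1 s := by
  have hs' : ∀ m : ℕ, 2 * s + 2 * m + 1 ≠ 0 := fun m => by simpa [qBracket] using hs m
  have hz : Complex.Gamma (s / 2 + 1 / 4) ≠ 0 := Complex.Gamma_ne_zero fun m h =>
    hs' (2 * m) (by push_cast; linear_combination 4 * h)
  have hz2 : Complex.Gamma (s / 2 + 1 / 4 + 1 / 2) ≠ 0 := Complex.Gamma_ne_zero fun m h =>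
    hs' (2 * m + 1) (by push_cast; linear_combination 4 * h)
  have hd := Complex.Gamma_mul_Gamma_add_half (s / 2 + 1 / 4)
  have hr := Complex.Gamma_mul_Gamma_one_sub (s / 2 + 1 / 4)
  have hπ : (Real.pi : ℂ) ≠ 0 := by exact_mod_cast Real.pi_ne_zero
  have hπ2 : (Real.sqrt Real.pi : ℂ) ≠ 0 := by
    exact_mod_cast (Real.sqrt_pos.mpr Real.pi_pos).ne'
  have hππ : (Real.sqrt Real.pi : ℂ) ^ 2 = Real.pi := by
    exact_mod_cast Real.sq_sqrt Real.pi_pos.le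
  have h22 : (Real.sqrt 2 : ℂ) ^ 2 = 2 := by
    exact_mod_cast Real.sq_sqrt (by norm_num : (0 : ℝ) ≤ 2)
  have h20 : (Real.sqrt 2 : ℂ) ≠ 0 := fun h => by simp [h] at h22
  have hp : (2 : ℂ) ^ (1 - 2 * (s / 2 + 1 / 4)) = (Real.sqrt 2 : ℂ) * ((2 : ℂ) ^ s)⁻¹ := by
    rw [show 1 - 2 * (s / 2 + 1 / 4) = ((1 / 2 : ℝ) : ℂ) + -s by push_cast; ring,
      Complex.cpow_add _ _ two_ne_zero, Complex.cpow_neg, Real.sqrt_eq_rpow,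
      Complex.ofReal_cpow (by norm_num)]
    push_cast; rfl
  have h2s : (2 : ℂ) ^ s ≠ 0 := by simp [Complex.cpow_eq_zero_iff]
  rw [hp, show 2 * (s / 2 + 1 / 4) = s + 1 / 2 by ring] at hd
  have hinv : (Complex.Gamma (3 / 4 - s / 2))⁻¹ =
      Complex.Gamma (s / 2 + 1 / 4) * Complex.sin (Real.pi * (s / 2 + 1 / 4)) / Real.pi := by
    rw [show (3 : ℂ) / 4 - s / 2 = 1 - (s / 2 + 1 / 4) by ring]
    have : Complex.Gamma (1 - (s / 2 + 1 / 4)) =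
      Real.pi / Complex.sin (Real.pi * (s / 2 + 1 / 4)) / Complex.Gamma (s / 2 + 1 / 4) := by
      rw [eq_div_iff hz, ← hr, mul_comm]
    rw [this]
    simp only [div_eq_mul_inv, mul_inv, inv_inv]
    ring
  have h12s : Complex.Gamma (s + 1 / 2) = Complex.Gamma (s / 2 + 1 / 4) *
      Complex.Gamma (s / 2 + 1 / 4 + 1 / 2) * (2 : ℂ) ^ s /
        ((Real.sqrt 2 : ℂ) * (Real.sqrt Real.pi : ℂ)) := by
    rw [hd]
    field_simp
  rw [qGammaSide, qBinom_one, hC, onePlusSinPi_one, ← sin_sq_shift, qProdOne,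
    div_eq_mul_inv ((2 : ℂ) ^ s * _), mul_inv, ← inv_pow, hinv]
  simp only [qGamma, qFactorial, one_pow, if_true, sub_add_cancel]
  rw [show s - 1 / 2 + 1 = s + 1 / 2 by ring, show s - 1 / 2 - s + 1 = 1 / 2 by ring,
    gamma_one_half, h12s,
    show (2 * s + 1) / 4 = s / 2 + 1 / 4 by ring,
    show (2 * s + 3) / 4 = s / 2 + 1 / 4 + 1 / 2 by ring, Real.sqrt_mul (by norm_num)]
  push_cast
  generalize Complex.Gamma (s / 2 + 1 / 4) = G at *
  generalize Complex.Gamma (s / 2 + 1 / 4 + 1 / 2) = G2 at *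
  generalize Complex.sin (Real.pi * (s / 2 + 1 / 4)) = S at *
  rw [← hππ]
  by_cases hg : Complex.Gamma (s + 1) = 0
  · simp [hg]
  field_simp
  rw [h22]

/-! ### The limit `q → 1⁻` -/

lemma eventually_lt_one : ∀ᶠ p : ℝ in 𝓝[<] 1, 0 < p ∧ p < 1 := by
  filter_upwards [self_mem_nhdsWithin, mem_nhdsWithin_of_mem_nhds (Ioi_mem_nhds zero_lt_one)]
    with p h1 h0 using ⟨h0, h1⟩

lemma tendsto_pow_nhdsLT_one {k : ℕ} (hk : k ≠ 0) :
    Tendsto (fun q : ℝ => q ^ k) (𝓝[<] 1) (𝓝[<] 1) := by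
  refine tendsto_nhdsWithin_iff.mpr ⟨?_, ?_⟩
  · have : Tendsto (fun q : ℝ => q ^ k) (𝓝 1) (𝓝 (1 ^ k)) := (continuous_pow k).tendsto 1
    rw [one_pow] at this
    exact this.mono_left nhdsWithin_le_nhds
  · filter_upwards [eventually_lt_one] with q hq
    exact pow_lt_one₀ hq.1.le hq.2 hk

lemma tendsto_cpow_nhdsLT_one (z : ℂ) :
    Tendsto (fun p : ℝ => (p : ℂ) ^ z) (𝓝[<] 1) (𝓝 1) := by
  have h : ContinuousAt (fun p : ℝ => (p : ℂ) ^ z) 1 :=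
    Complex.continuous_ofReal.continuousAt.cpow continuousAt_const (by simp)
  simpa [ContinuousAt] using h.tendsto.mono_left nhdsWithin_le_nhds

/-- The `q`-bracket `[z]_p` tends to `z`. -/
lemma tendsto_one_sub_cpow_div (z : ℂ) :
    Tendsto (fun p : ℝ => (1 - (p : ℂ) ^ z) / (1 - (p : ℂ))) (𝓝[<] 1) (𝓝 z) := by
  have h1 : HasDerivAt (fun w : ℂ => w ^ z) z 1 := by
    simpa using (hasDerivAt_id (1 : ℂ)).cpow_const (c := z) (by simp)
  have h2 := h1.tendsto_slope
  have h3 : Tendsto (fun p : ℝ => (p : ℂ)) (𝓝[<] 1) (𝓝[≠] 1) := by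
    refine tendsto_nhdsWithin_iff.mpr ⟨?_, ?_⟩
    · simpa using (Complex.continuous_ofReal.tendsto 1).mono_left nhdsWithin_le_nhds
    · filter_upwards [eventually_lt_one] with p hp
      simpa using hp.2.ne
  refine (h2.comp h3).congr fun p => ?_
  rw [Function.comp_apply, slope_def_field, Complex.one_cpow, ← neg_sub, ← neg_sub (1 : ℂ) p,
    neg_div_neg_eq]

lemma eventually_norm_one_sub_cpow_le (z : ℂ) :
    ∀ᶠ p : ℝ in 𝓝[<] 1, ‖1 - (p : ℂ) ^ z‖ ≤ (‖z‖ + 1) * (1 - p) := by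
  filter_upwards [(tendsto_one_sub_cpow_div z).norm.eventually_le_const
    (show ‖z‖ < ‖z‖ + 1 by linarith), eventually_lt_one] with p hp hp1
  have h : (0 : ℝ) < 1 - p := by linarith [hp1.2]
  have e : ‖(1 : ℂ) - p‖ = 1 - p := by
    rw [← Complex.ofReal_one, ← Complex.ofReal_sub, Complex.norm_real, Real.norm_of_nonneg h.le]
  rwa [norm_div, e, div_le_iff₀ h] at hp

/-- This is `2 sinh (u / 2) ≥ u` for `u = -x log p`, together with `-log p ≥ 1 - p`. -/
lemma rpow_half_mul_le {p x : ℝ} (h0 : 0 < p) (h1 : p < 1) (hx : 0 ≤ x) :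
    p ^ (x / 2) * (x * (1 - p)) ≤ 1 - p ^ x := by
  have hl : 1 - p ≤ -Real.log p := by linarith [Real.log_le_sub_one_of_pos h0]
  set u := -Real.log p * x with hu
  have hu0 : 0 ≤ u := mul_nonneg (by linarith) hx
  have hs := Real.self_le_sinh_iff.mpr (show 0 ≤ u / 2 by linarith)
  rw [Real.sinh_eq] at hs
  have e1 : p ^ (x / 2) = Real.exp (-(u / 2)) := by
    rw [Real.rpow_def_of_pos h0, hu]; ring_nf
  have e2 : p ^ x = Real.exp (-(u / 2)) * Real.exp (-(u / 2)) := by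
    rw [Real.rpow_def_of_pos h0, ← Real.exp_add, hu]; ring_nf
  have e3 : Real.exp (-(u / 2)) * Real.exp (u / 2) = 1 := by rw [← Real.exp_add]; simp
  have e4 : x * (1 - p) ≤ u := by rw [hu, mul_comm]; exact mul_le_mul_of_nonneg_right hl hx
  rw [e1, e2]
  have hpos := Real.exp_pos (-(u / 2))
  nlinarith [mul_le_mul_of_nonneg_left hs hpos.le, mul_le_mul_of_nonneg_left e4 hpos.le]

lemma rpow_mul_sq_div_le {p x y e : ℝ} (h0 : 0 < p) (h1 : p < 1) (he : 0 < e) (hx : e ≤ x)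
    (hy : e ≤ y) :
    p ^ x * (1 - p) ^ 2 / ((1 - p ^ x) * (1 - p ^ y)) ≤ 1 / e ^ 2 := by
  have hpx : p ^ x ≤ p ^ e := Real.rpow_le_rpow_of_exponent_ge h0 h1.le hx
  have hpy : p ^ y ≤ p ^ e := Real.rpow_le_rpow_of_exponent_ge h0 h1.le hy
  have hpe : p ^ e < 1 := Real.rpow_lt_one h0.le h1 he
  have h2 := rpow_half_mul_le h0 h1 he.le
  have hpp : 0 < p ^ (e / 2) := Real.rpow_pos_of_pos h0 _
  have hsq : p ^ e = p ^ (e / 2) * p ^ (e / 2) := by rw [← Real.rpow_add h0]; ring_nf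
  have h1p : 0 < 1 - p := by linarith
  rw [div_le_div_iff₀ (mul_pos (by linarith) (by linarith)) (by positivity), one_mul]
  calc p ^ x * (1 - p) ^ 2 * e ^ 2 ≤ p ^ e * (1 - p) ^ 2 * e ^ 2 := by gcongr
    _ = (p ^ (e / 2) * (e * (1 - p))) * (p ^ (e / 2) * (e * (1 - p))) := by rw [hsq]; ring
    _ ≤ (1 - p ^ e) * (1 - p ^ e) := by gcongr
    _ ≤ (1 - p ^ x) * (1 - p ^ y) := by gcongr; linarith

lemma norm_one_sub_rpow {p x : ℝ} (h0 : 0 < p) (h1 : p < 1) (hx : 0 < x) :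
    ‖1 - (p : ℂ) ^ (x : ℂ)‖ = 1 - p ^ x := by
  rw [← Complex.ofReal_cpow h0.le, ← Complex.ofReal_one, ← Complex.ofReal_sub, Complex.norm_real,
    Real.norm_of_nonneg (by linarith [Real.rpow_lt_one h0.le h1 hx])]

lemma qPoch_rpow_ne_zero {p x : ℝ} (h0 : 0 < p) (h1 : p < 1) (hx : 0 < x) :
    qPoch p ((p : ℂ) ^ (x : ℂ)) ≠ 0 := by
  refine qPoch_ne_zero_of_norm_lt_one h0 h1 ?_
  rw [← Complex.ofReal_cpow h0.le, Complex.norm_real, Real.norm_of_nonneg (by positivity)]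
  exact Real.rpow_lt_one h0.le h1 hx

/-- When `a + b = c + d` the quotient of `q`-Pochhammer symbols tends to the quotient of Gamma
functions: its factors are `1 + O(1/n²)` uniformly in the base, so that the limit may be taken
factor by factor. -/
lemma tendsto_qPoch_quotient {a b : ℂ} {c d : ℝ} (hc : 0 < c) (hd : 0 < d) (h : a + b = c + d) :
    Tendsto (fun p : ℝ => qPoch p ((p : ℂ) ^ a) * qPoch p ((p : ℂ) ^ b) /
      (qPoch p ((p : ℂ) ^ (c : ℂ)) * qPoch p ((p : ℂ) ^ (d : ℂ)))) (𝓝[<] 1)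
      (𝓝 (Complex.Gamma c * Complex.Gamma d / (Complex.Gamma a * Complex.Gamma b))) := by
  set e := min c d
  have he0 : 0 < e := lt_min hc hd
  set F : ℝ → ℕ → ℂ := fun p n =>
    (1 - (p : ℂ) ^ n * (p : ℂ) ^ a) * (1 - (p : ℂ) ^ n * (p : ℂ) ^ b) /
      ((1 - (p : ℂ) ^ n * (p : ℂ) ^ (c : ℂ)) * (1 - (p : ℂ) ^ n * (p : ℂ) ^ (d : ℂ))) with hF
  have hcomm : ∀ p : ℝ, 0 < p → ∀ (n : ℕ) (z : ℂ),
      (p : ℂ) ^ n * (p : ℂ) ^ z = (p : ℂ) ^ ((n : ℂ) + z) := fun p h0 n z => by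
    rw [add_comm, cpow_add_natCast h0, mul_comm]
  have hpt : ∀ n : ℕ, Tendsto (fun p => F p n - 1) (𝓝[<] 1)
      (𝓝 (((n + a) * (n + b)) / ((n + c) * (n + d)) - 1)) := by
    intro n
    have hnc : (n : ℂ) + c ≠ 0 := natCast_add_ne_zero_of_re_pos (by simpa using hc) n
    have hnd : (n : ℂ) + d ≠ 0 := natCast_add_ne_zero_of_re_pos (by simpa using hd) n
    have hl := (((tendsto_one_sub_cpow_div (n + a)).mul (tendsto_one_sub_cpow_div (n + b))).div
      ((tendsto_one_sub_cpow_div (n + c)).mul (tendsto_one_sub_cpow_div (n + d)))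
      (mul_ne_zero hnc hnd)).sub_const 1
    refine hl.congr' ?_
    filter_upwards [eventually_lt_one] with p ⟨h0, h1⟩
    have := one_sub_ofReal_ne_zero h1
    simp only [hF, Pi.div_apply]
    rw [hcomm p h0, hcomm p h0, hcomm p h0, hcomm p h0, div_mul_div_comm, div_mul_div_comm,
      div_div_div_cancel_right₀ (mul_ne_zero this this)]
  have hbd : ∀ᶠ p : ℝ in 𝓝[<] 1, ∀ n : ℕ, ‖F p n - 1‖ ≤
      ((‖a - c‖ + 1) * (‖b - c‖ + 1)) * (1 / ((n : ℝ) + e) ^ 2) := by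
    filter_upwards [eventually_lt_one, eventually_norm_one_sub_cpow_le (a - c),
      eventually_norm_one_sub_cpow_le (b - c)] with p ⟨h0, h1⟩ hpa hpb n
    have hp : (p : ℂ) ≠ 0 := by exact_mod_cast h0.ne'
    have hnn : (0 : ℝ) ≤ n := Nat.cast_nonneg n
    have hxc : ∀ x : ℝ, 0 < x → ‖1 - (p : ℂ) ^ n * (p : ℂ) ^ (x : ℂ)‖ = 1 - p ^ ((n : ℝ) + x) := by
      intro x hx
      rw [hcomm p h0, ← norm_one_sub_rpow h0 h1 (by positivity)]
      push_cast; rfl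
    have hlt : ∀ x : ℝ, 0 < x → 0 < 1 - p ^ ((n : ℝ) + x) := fun x hx => by
      linarith [Real.rpow_lt_one h0.le h1 (show 0 < (n : ℝ) + x by positivity)]
    have hC : (p : ℂ) ^ (c : ℂ) ≠ 0 := by simp [Complex.cpow_eq_zero_iff, hp]
    have hsub : ∀ z : ℂ, (p : ℂ) ^ (c : ℂ) - (p : ℂ) ^ z =
        (p : ℂ) ^ (c : ℂ) * (1 - (p : ℂ) ^ (z - c)) := fun z => by
      rw [mul_sub, mul_one, ← Complex.cpow_add _ _ hp, add_sub_cancel]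
    simp only [hF]
    rw [one_sub_mul_div_mul_eq hC (by rw [← Complex.cpow_add _ _ hp, ← Complex.cpow_add _ _ hp, h])
      _ (norm_pos_iff.mp (by rw [hxc c hc]; exact hlt c hc))
      (norm_pos_iff.mp (by rw [hxc d hd]; exact hlt d hd)), hsub, hsub]
    have e1 : ∀ x C A B D : ℂ, C ≠ 0 → x * (C * A) * (C * B) / (C * D) = (x * C) * (A * B) / D :=
      fun x C A B D hC => by field_simp
    rw [e1 _ _ _ _ _ hC, norm_div, norm_mul ((p : ℂ) ^ n * (p : ℂ) ^ (c : ℂ)),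
      norm_mul (1 - (p : ℂ) ^ (a - c)), norm_mul (1 - (p : ℂ) ^ n * (p : ℂ) ^ (c : ℂ)),
      hxc c hc, hxc d hd,
      hcomm p h0, show (n : ℂ) + (c : ℂ) = ((n + c : ℝ) : ℂ) by push_cast; rfl,
      ← Complex.ofReal_cpow h0.le, Complex.norm_real, Real.norm_of_nonneg (by positivity)]
    calc p ^ ((n : ℝ) + c) * (‖1 - (p : ℂ) ^ (a - c)‖ * ‖1 - (p : ℂ) ^ (b - c)‖) /
          ((1 - p ^ ((n : ℝ) + c)) * (1 - p ^ ((n : ℝ) + d)))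
        ≤ p ^ ((n : ℝ) + c) * (((‖a - c‖ + 1) * (1 - p)) * ((‖b - c‖ + 1) * (1 - p))) /
          ((1 - p ^ ((n : ℝ) + c)) * (1 - p ^ ((n : ℝ) + d))) := by
          have := mul_pos (hlt c hc) (hlt d hd)
          have : 0 ≤ 1 - p := by linarith
          gcongr
      _ = ((‖a - c‖ + 1) * (‖b - c‖ + 1)) * (p ^ ((n : ℝ) + c) * (1 - p) ^ 2 /
          ((1 - p ^ ((n : ℝ) + c)) * (1 - p ^ ((n : ℝ) + d)))) := by ring
      _ ≤ _ := by
          refine mul_le_mul_of_nonneg_left (rpow_mul_sq_div_le h0 h1 (by positivity)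
            (add_le_add_right (min_le_left _ _) _) (add_le_add_right (min_le_right _ _) _))
            (by positivity)
  have hmain := tendsto_tprod_one_add_of_dominated_convergence
    ((summable_one_div_add_sq e).mul_left _) hpt hbd
  simp only [add_sub_cancel] at hmain
  rw [(hasProd_gamma_quotient (c := c) (d := d) (by simpa using hc) (by simpa using hd) h).tprod_eq]
    at hmain
  refine hmain.congr' ?_
  filter_upwards [eventually_lt_one] with p ⟨h0, h1⟩
  have hq := ((hasProd_qPoch h0 h1 ((p : ℂ) ^ a)).mul (hasProd_qPoch h0 h1 ((p : ℂ) ^ b))).div₀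
    ((hasProd_qPoch h0 h1 ((p : ℂ) ^ (c : ℂ))).mul (hasProd_qPoch h0 h1 ((p : ℂ) ^ (d : ℂ))))
    (mul_ne_zero (qPoch_rpow_ne_zero h0 h1 hc) (qPoch_rpow_ne_zero h0 h1 hd))
  rw [← hq.tprod_eq]
  refine tprod_congr fun n => ?_
  simp only [hF, mul_comm ((p : ℂ) ^ n)]

/-- The product side is split over the base `q⁴` into three balanced quotients. -/
lemma tendsto_qProdAux (s : ℂ) :
    Tendsto (fun q : ℝ => qProdAux q s) (𝓝[<] 1) (𝓝 (qProdOne s)) := by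
  have hp := tendsto_pow_nhdsLT_one (k := 4) four_ne_zero
  have h1 := (tendsto_qPoch_quotient (a := 3 / 4 - s / 2) (b := 1 / 2 + s / 2) (c := 1 / 2)
    (d := 3 / 4) (by norm_num) (by norm_num) (by push_cast; ring)).comp hp
  have h2 := (tendsto_qPoch_quotient (a := 3 / 4 - s / 2) (b := 1 + s / 2) (c := 1)
    (d := 3 / 4) (by norm_num) (by norm_num) (by push_cast; ring)).comp hp
  have h3 := (tendsto_qPoch_quotient (a := 3 / 4) (b := 3 / 4) (c := 1 / 2)
    (d := 1) (by norm_num) (by norm_num) (by push_cast; ring)).comp hp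
  have h := (tendsto_cpow_nhdsLT_one (s ^ 2 - s)).mul ((h1.mul h2).mul h3)
  push_cast at h
  rw [gamma_quotients_eq_qProdOne, one_mul] at h
  refine h.congr' ?_
  filter_upwards [eventually_lt_one] with q ⟨hq0, hq1⟩
  have h20 : 0 < q ^ 2 := by positivity
  have h21 : q ^ 2 < 1 := pow_lt_one₀ hq0.le hq1 two_ne_zero
  have hqc : (q : ℂ) ≠ 0 := by exact_mod_cast hq0.ne'
  have hpow : ∀ z w : ℂ, 4 * z = w → ((q : ℂ) ^ 4) ^ z = (q : ℂ) ^ w := fun z w hz => by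
    rw [← Complex.ofReal_pow, ofReal_pow_cpow hq0, ← hz]; push_cast; rfl
  have e2 := qPoch_sq_mul h20 h21 ((q : ℂ) ^ 2)
  have e3 := qPoch_sq_mul h20 h21 ((q : ℂ) ^ (2 * s + 2))
  rw [show (q ^ 2) ^ 2 = q ^ 4 by ring] at e2 e3
  rw [show (q : ℂ) ^ 2 * ((q ^ 2 : ℝ) : ℂ) = (q : ℂ) ^ 4 by push_cast; ring] at e2
  rw [show (q : ℂ) ^ (2 * s + 2) * ((q ^ 2 : ℝ) : ℂ) = (q : ℂ) ^ (2 * s + 4) by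
    rw [Complex.ofReal_pow, ← cpow_add_natCast hq0]; push_cast; ring_nf] at e3
  rw [qProdAux, (hasProd_qProdFactor hq0 hq1 s).tprod_eq, e2, e3]
  simp only [Function.comp_apply]
  push_cast
  rw [hpow (3 / 4 - s / 2) (3 - 2 * s) (by ring), hpow (1 / 2 + s / 2) (2 * s + 2) (by ring),
    hpow (1 + s / 2) (2 * s + 4) (by ring), hpow (3 / 4) (3 : ℕ) (by norm_num),
    hpow (1 / 2) (2 : ℕ) (by norm_num), hpow 1 (4 : ℕ) (by norm_num), Complex.cpow_natCast,
    Complex.cpow_natCast, Complex.cpow_natCast]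
  have n2 := qPoch_self_ne_zero hq0 hq1 four_ne_zero two_ne_zero
  have n3 := qPoch_self_ne_zero hq0 hq1 four_ne_zero three_ne_zero
  have n4 := qPoch_self_ne_zero hq0 hq1 four_ne_zero four_ne_zero
  generalize qPoch (q ^ 4) ((q : ℂ) ^ 2) = x2 at *
  generalize qPoch (q ^ 4) ((q : ℂ) ^ 3) = x3 at *
  generalize qPoch (q ^ 4) ((q : ℂ) ^ 4) = x4 at *
  generalize qPoch (q ^ 4) ((q : ℂ) ^ (3 - 2 * s)) = y1
  generalize qPoch (q ^ 4) ((q : ℂ) ^ (2 * s + 2)) = y2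
  generalize qPoch (q ^ 4) ((q : ℂ) ^ (2 * s + 4)) = y3
  field_simp

lemma qProdSide_one (s : ℂ) : qProdSide 1 s = qProdOne s := by
  rw [qProdSide, if_pos rfl]
  exact (tendsto_qProdAux s).limUnder_eq

lemma tendsto_qProdSide (s : ℂ) :
    Tendsto (fun q : ℝ => qProdSide q s) (𝓝[<] 1) (𝓝 (qProdSide 1 s)) := by
  rw [qProdSide_one]
  refine (tendsto_qProdAux s).congr' ?_
  filter_upwards [eventually_lt_one] with q hq
  rw [qProdSide, if_neg hq.2.ne]

/-- The square of `C₂(q)` is `[4]_q⁻¹` times a balanced quotient of Pochhammer symbols. -/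
lemma qConstTwo_sq {q : ℝ} (h0 : 0 < q) (h1 : q < 1) :
    (qConstTwo q : ℂ) ^ 2 = ((1 - (q : ℂ) ^ (4 : ℂ)) / (1 - q))⁻¹ *
      (qPoch (q ^ 2) q * qPoch (q ^ 2) ((q : ℂ) ^ 3) /
        (qPoch (q ^ 2) ((q : ℂ) ^ 2) * qPoch (q ^ 2) ((q : ℂ) ^ 2))) := by
  have h20 : 0 < q ^ 2 := by positivity
  have h21 : q ^ 2 < 1 := pow_lt_one₀ h0.le h1 two_ne_zero
  have h41 : q ^ 4 < 1 := pow_lt_one₀ h0.le h1 four_ne_zero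
  have hne4 := one_sub_ofReal_ne_zero h41
  have hsq : ((1 - ((q ^ 4 : ℝ) : ℂ)) ^ (-(1 / 2) : ℂ)) ^ 2 = (1 - ((q ^ 4 : ℝ) : ℂ))⁻¹ := by
    rw [← Complex.cpow_nat_mul, show ((2 : ℕ) : ℂ) * (-(1 / 2)) = -1 by push_cast; ring,
      Complex.cpow_neg_one]
  -- Splitting off one factor, `(q; q²)_∞ = (1 - q) (q³; q²)_∞`, makes the square balanced.
  have e := qPoch_eq_mul h20 h21 (q : ℂ)
  rw [show (q : ℂ) * ((q ^ 2 : ℝ) : ℂ) = (q : ℂ) ^ 3 by push_cast; ring] at e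
  have e4 : (q : ℂ) ^ (4 : ℂ) = ((q ^ 4 : ℝ) : ℂ) := by
    rw [show (4 : ℂ) = (4 : ℕ) by norm_num, Complex.cpow_natCast]; push_cast; rfl
  rw [qConstTwo_of_lt_one h0 h1, mul_pow, hsq, e4, inv_div, e]
  ring

lemma qConstTwo_nonneg {q : ℝ} (h0 : 0 < q) (h1 : q < 1) : 0 ≤ qConstTwo q := by
  have hle : ∀ n : ℕ, 0 ≤ 1 - q ^ n := fun n => by linarith [pow_le_one₀ (n := n) h0.le h1.le]
  rw [qConstTwo, if_neg h1.ne, qConstTwoAux]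
  exact mul_nonneg (Real.rpow_nonneg (hle 4) _) (tprod_nonneg fun n => div_nonneg (hle _) (hle _))

lemma tendsto_qConstTwo : Tendsto qConstTwo (𝓝[<] 1) (𝓝 (1 / Real.sqrt (2 * Real.pi))) := by
  have hp := tendsto_pow_nhdsLT_one (k := 2) two_ne_zero
  have h1 := (tendsto_qPoch_quotient (a := 1 / 2) (b := 3 / 2) (c := 1)
    (d := 1) (by norm_num) (by norm_num) (by push_cast; ring)).comp hp
  have h2 := ((tendsto_one_sub_cpow_div 4).inv₀ (by norm_num : (4 : ℂ) ≠ 0)).mul h1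
  have h3 : Tendsto (fun q : ℝ => (qConstTwo q : ℂ) ^ 2) (𝓝[<] 1)
      (𝓝 (((1 / (2 * Real.pi) : ℝ)) : ℂ)) := by
    have hv : (4 : ℂ)⁻¹ * (Complex.Gamma ((1 : ℝ) : ℂ) * Complex.Gamma ((1 : ℝ) : ℂ) /
        (Complex.Gamma (1 / 2) * Complex.Gamma (3 / 2))) = ((1 / (2 * Real.pi) : ℝ) : ℂ) := by
      have hππ : (Real.sqrt Real.pi : ℂ) ^ 2 = Real.pi := by
        exact_mod_cast Real.sq_sqrt Real.pi_pos.le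
      have hπ2 : (Real.sqrt Real.pi : ℂ) ≠ 0 := by
        exact_mod_cast (Real.sqrt_pos.mpr Real.pi_pos).ne'
      rw [show (3 : ℂ) / 2 = 1 / 2 + 1 by norm_num, Complex.Gamma_add_one _ (by norm_num),
        gamma_one_half,
        Complex.ofReal_one, Complex.Gamma_one]
      push_cast
      rw [← hππ]
      field_simp
      norm_num
    rw [← hv]
    refine h2.congr' ?_
    filter_upwards [eventually_lt_one] with q ⟨hq0, hq1⟩
    have hpow : ∀ (z : ℂ) (k : ℕ), 2 * z = k → ((q ^ 2 : ℝ) : ℂ) ^ z = (q : ℂ) ^ k :=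
      fun z k hz => by
        rw [ofReal_pow_cpow hq0, Nat.cast_ofNat, hz, Complex.cpow_natCast]
    rw [qConstTwo_sq hq0 hq1, Function.comp_apply, hpow (1 / 2) 1 (by norm_num),
      hpow (3 / 2) 3 (by norm_num), hpow ((1 : ℝ) : ℂ) 2 (by norm_num), pow_one]
  have h4 : Tendsto (fun q : ℝ => (qConstTwo q) ^ 2) (𝓝[<] 1) (𝓝 (1 / (2 * Real.pi))) := by
    have := (Complex.continuous_re.tendsto _).comp h3
    rw [Complex.ofReal_re] at this
    refine this.congr fun q => ?_
    rw [Function.comp_apply, ← Complex.ofReal_pow, Complex.ofReal_re]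
  have h5 := (Real.continuous_sqrt.tendsto _).comp h4
  rw [Real.sqrt_div zero_le_one, Real.sqrt_one] at h5
  refine h5.congr' ?_
  filter_upwards [eventually_lt_one] with q ⟨hq0, hq1⟩
  exact Real.sqrt_sq (qConstTwo_nonneg hq0 hq1)

lemma qConstTwo_one : qConstTwo 1 = 1 / Real.sqrt (2 * Real.pi) := by
  rw [qConstTwo, if_pos rfl]
  refine Tendsto.limUnder_eq (tendsto_qConstTwo.congr' ?_)
  filter_upwards [eventually_lt_one] with q hq
  rw [qConstTwo, if_neg hq.2.ne]

/-! ### The exceptional points -/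

lemma eventually_forall_ne {f : ℕ → ℂ → ℂ} {s c : ℂ} {N : ℕ}
    (hN : ∀ᶠ z in 𝓝 s, ∀ m, N ≤ m → f m z ≠ c) (h : ∀ m, ∀ᶠ z in 𝓝[≠] s, f m z ≠ c) :
    ∀ᶠ z in 𝓝[≠] s, ∀ m, f m z ≠ c := by
  have h1 : ∀ᶠ z in 𝓝[≠] s, ∀ m ∈ Finset.range N, f m z ≠ c :=
    (eventually_all_finset _).mpr fun m _ => h m
  filter_upwards [h1, hN.filter_mono nhdsWithin_le_nhds] with z hz1 hz2 m
  by_cases hm : m < N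
  · exact hz1 m (Finset.mem_range.mpr hm)
  · exact hz2 m (not_lt.mp hm)

/-- The points where the Gamma expression is of the form `0 · ∞` are isolated. -/
lemma eventually_qBracket_ne_zero {q : ℝ} (h0 : 0 < q) (h1 : q ≤ 1) (s : ℂ) :
    ∀ᶠ z in 𝓝[≠] s, ∀ m : ℕ, qBracket q (2 * z + 2 * m + 1) ≠ 0 := by
  -- Near `s` only finitely many `m` matter: for `m ≥ N` the exponent has positive real part.
  obtain ⟨N, hN⟩ := exists_nat_gt (-s.re)
  have hre : ∀ᶠ z : ℂ in 𝓝 s, ∀ m : ℕ, N ≤ m → 0 < (2 * z + 2 * m + 1).re := by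
    filter_upwards [Complex.continuous_re.continuousAt.eventually_const_lt
      (show -(N : ℝ) < s.re by linarith)] with z hz m hm
    have : (N : ℝ) ≤ m := by exact_mod_cast hm
    simp
    linarith
  have hlin : ∀ m : ℕ, HasDerivAt (fun z : ℂ => 2 * z + 2 * m + 1) 2 s := fun m => by
    simpa using (((hasDerivAt_id s).const_mul 2).add_const (2 * (m : ℂ))).add_const 1
  rcases h1.eq_or_lt with rfl | h1
  · simp only [qBracket, if_true]
    refine eventually_forall_ne (N := N) ?_ fun m =>
      (hlin m).eventually_ne two_ne_zero
    filter_upwards [hre] with z hz m hm h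
    simpa [h] using hz m hm
  · have hq : (q : ℂ) ≠ 0 := by exact_mod_cast h0.ne'
    have hne := one_sub_ofReal_ne_zero h1
    have hlog : Complex.log q ≠ 0 := by
      rw [← Complex.ofReal_log h0.le]
      exact_mod_cast (Real.log_neg h0 h1).ne
    have key : ∀ z : ℂ, qBracket q z ≠ 0 ↔ (q : ℂ) ^ z ≠ 1 := fun z => by
      rw [qBracket, if_neg h1.ne, ne_eq, div_eq_zero_iff, not_or, sub_eq_zero]
      simp only [hne, not_false_eq_true, and_true]
      exact ne_comm
    simp only [key]
    refine eventually_forall_ne (N := N) ?_ fun m =>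
      ((hlin m).const_cpow (Or.inl hq)).eventually_ne ?_
    · filter_upwards [hre] with z hz m hm h
      have h2 := congrArg norm h
      rw [Complex.norm_cpow_eq_rpow_re_of_pos h0, norm_one] at h2
      exact (Real.rpow_lt_one h0.le h1 (hz m hm)).ne h2
    · exact mul_ne_zero (mul_ne_zero (by simp [Complex.cpow_eq_zero_iff, hq]) hlog) two_ne_zero

/-! ### The elliptic integral -/

/-- The coefficient `(2n - 1)!! / (2n)!! = (1/2)_n / n!`. -/
noncomputable def wallisCoeff (n : ℕ) : ℝ :=
  ∏ i ∈ Finset.range n, (2 * (i : ℝ) + 1) / (2 * i + 2)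

lemma wallisCoeff_nonneg (n : ℕ) : 0 ≤ wallisCoeff n :=
  Finset.prod_nonneg fun i _ => by positivity

lemma wallisCoeff_le_one (n : ℕ) : wallisCoeff n ≤ 1 :=
  Finset.prod_le_one (fun i _ => by positivity) fun i _ => by
    rw [div_le_one (by positivity)]; linarith

lemma choose_eq_wallisCoeff (n : ℕ) : Ring.choose ((1 / 2 : ℝ) + n - 1) n = wallisCoeff n := by
  have h := Ring.factorial_nsmul_multichoose_eq_ascPochhammer (1 / 2 : ℝ) n
  rw [Polynomial.ascPochhammer_smeval_eq_eval, Ring.multichoose_eq, nsmul_eq_mul] at h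
  have h2 : (ascPochhammer ℝ n).eval (1 / 2) = n.factorial * wallisCoeff n := by
    clear h
    induction n with
    | zero => simp [wallisCoeff]
    | succ n ih =>
      rw [ascPochhammer_succ_eval, ih, wallisCoeff, wallisCoeff, Finset.prod_range_succ,
        Nat.factorial_succ]
      push_cast
      field_simp
      ring
  rw [h2] at h
  exact mul_left_cancel₀ (by exact_mod_cast n.factorial_ne_zero) h

lemma hasSum_one_div_sqrt_one_sub {y : ℝ} (hy : |y| < 1) :
    HasSum (fun n => wallisCoeff n * y ^ n) (1 / Real.sqrt (1 - y)) := by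
  have h := (Real.one_div_one_sub_rpow_hasFPowerSeriesOnBall_zero (1 / 2)).hasSum (y := y)
    (by simpa [enorm_eq_nnnorm, ← NNReal.coe_lt_one] using hy)
  simp only [FormalMultilinearSeries.ofScalars_apply_eq, choose_eq_wallisCoeff, smul_eq_mul,
    zero_add] at h
  rwa [Real.sqrt_eq_rpow]

lemma image_cos_Ioo : Real.cos '' Set.Ioo 0 (Real.pi / 2) = Set.Ioo 0 1 := by
  ext y
  constructor
  · rintro ⟨x, ⟨h0, h1⟩, rfl⟩
    refine ⟨Real.cos_pos_of_mem_Ioo ⟨by linarith, h1⟩, ?_⟩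
    rw [← Real.cos_zero]
    exact Real.cos_lt_cos_of_nonneg_of_le_pi_div_two le_rfl h1.le h0
  · rintro ⟨h0, h1⟩
    exact ⟨Real.arccos y, ⟨Real.arccos_pos.mpr h1, Real.arccos_lt_pi_div_two.mpr h0⟩,
      Real.cos_arccos (by linarith) h1.le⟩

/-- The substitution `t = cos θ`. -/
lemma ellipticF_eq (x : ℝ) :
    ellipticF x = 2 / Real.pi *
      ∫ θ in (0 : ℝ)..(Real.pi / 2), 1 / Real.sqrt (1 - x * Real.cos θ ^ 2) := by
  have hπ := Real.pi_pos
  rw [ellipticF, intervalIntegral.integral_of_le zero_le_one,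
    intervalIntegral.integral_of_le (by positivity), MeasureTheory.integral_Ioc_eq_integral_Ioo,
    MeasureTheory.integral_Ioc_eq_integral_Ioo, ← image_cos_Ioo,
    MeasureTheory.integral_image_eq_integral_abs_deriv_smul measurableSet_Ioo
      (fun θ _ => (Real.hasDerivAt_cos θ).hasDerivWithinAt)
      (Real.injOn_cos.mono fun θ hθ => Set.mem_Icc.mpr ⟨hθ.1.le, by linarith [hθ.2]⟩)]
  congr 1
  refine MeasureTheory.setIntegral_congr_fun measurableSet_Ioo fun θ hθ => ?_
  have hs : 0 < Real.sin θ := Real.sin_pos_of_pos_of_lt_pi hθ.1 (by linarith [hθ.2])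
  simp only [abs_neg, abs_of_pos hs, smul_eq_mul]
  rw [← Real.sin_sq, Real.sqrt_sq hs.le, ← mul_div_assoc, mul_one, div_mul_eq_div_div,
    div_self hs.ne']

lemma integral_cos_pow_even (n : ℕ) :
    ∫ θ in (0 : ℝ)..(Real.pi / 2), Real.cos θ ^ (2 * n) = Real.pi / 2 * wallisCoeff n := by
  rw [EulerSine.integral_cos_pow_eq, integral_sin_pow_even, wallisCoeff]
  ring

lemma hasSum_ellipticF {x : ℝ} (hx : |x| < 1) :
    HasSum (fun n => wallisCoeff n ^ 2 * x ^ n) (ellipticF x) := by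
  have hb : ∀ θ : ℝ, |x * Real.cos θ ^ 2| ≤ |x| := fun θ => by
    rw [abs_mul, abs_of_nonneg (sq_nonneg (Real.cos θ))]
    exact mul_le_of_le_one_right (abs_nonneg x) (Real.cos_sq_le_one θ)
  have h := intervalIntegral.hasSum_integral_of_dominated_convergence (μ := MeasureTheory.volume)
    (a := 0) (b := Real.pi / 2)
    (F := fun n θ => wallisCoeff n * (x * Real.cos θ ^ 2) ^ n)
    (f := fun θ => 1 / Real.sqrt (1 - x * Real.cos θ ^ 2)) (fun n _ => |x| ^ n)
    (fun n => (by fun_prop : Continuous fun θ =>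
      wallisCoeff n * (x * Real.cos θ ^ 2) ^ n).aestronglyMeasurable)
    (fun n => Eventually.of_forall fun θ _ => by
      rw [Real.norm_eq_abs, abs_mul, abs_pow, abs_of_nonneg (wallisCoeff_nonneg n)]
      exact (mul_le_of_le_one_left (by positivity) (wallisCoeff_le_one n)).trans
        (pow_le_pow_left₀ (abs_nonneg _) (hb θ) n))
    (Eventually.of_forall fun θ _ => summable_geometric_of_lt_one (abs_nonneg x) hx)
    intervalIntegrable_const
    (Eventually.of_forall fun θ _ => hasSum_one_div_sqrt_one_sub ((hb θ).trans_lt hx))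
  have h2 := h.mul_left (2 / Real.pi)
  rw [← ellipticF_eq] at h2
  refine h2.congr_fun fun n => ?_
  have hπ := Real.pi_ne_zero
  simp_rw [mul_pow, ← pow_mul]
  rw [intervalIntegral.integral_const_mul, intervalIntegral.integral_const_mul,
    integral_cos_pow_even]
  field_simp

/-! ### Iterated derivatives of power series -/

section PowerSeries

variable {c : ℕ → ℝ}

lemma summable_descFactorial_mul (hc : ∀ n, |c n| ≤ 1) (m : ℕ) {x : ℝ} (hx : |x| < 1) :
    Summable fun n : ℕ => ((n + m).descFactorial m : ℝ) * c (n + m) * x ^ n := by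
  have h := summable_descFactorial_mul_geometric_of_norm_lt_one m (r := |x|) (by simpa using hx)
  refine Summable.of_norm_bounded h fun n => ?_
  rw [Real.norm_eq_abs, abs_mul, abs_mul, abs_pow, Nat.abs_cast]
  exact mul_le_mul_of_nonneg_right (mul_le_of_le_one_right (Nat.cast_nonneg _) (hc _))
    (by positivity)

lemma hasDerivAt_tsum_descFactorial (hc : ∀ n, |c n| ≤ 1) (m : ℕ) {x : ℝ} (hx : |x| < 1) :
    HasDerivAt (fun y : ℝ => ∑' n : ℕ, ((n + m).descFactorial m : ℝ) * c (n + m) * y ^ n)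
      (∑' n : ℕ, ((n + (m + 1)).descFactorial (m + 1) : ℝ) * c (n + (m + 1)) * x ^ n) x := by
  obtain ⟨r, hr0, hr1⟩ := exists_between hx
  have hrpos : 0 < r := (abs_nonneg x).trans_lt hr0
  have hdesc : ∀ n : ℕ, ((n + 1 + m).descFactorial m : ℝ) * (n + 1) =
      ((n + (m + 1)).descFactorial (m + 1) : ℝ) := fun n => by
    rw [Nat.descFactorial_succ, show n + (m + 1) - m = n + 1 by omega,
      show n + (m + 1) = n + 1 + m by omega]
    push_cast
    ring
  have hterm : ∀ (n : ℕ) (y : ℝ),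
      ((n + 1 + m).descFactorial m : ℝ) * c (n + 1 + m) * ((n + 1 : ℕ) * y ^ (n + 1 - 1)) =
      ((n + (m + 1)).descFactorial (m + 1) : ℝ) * c (n + (m + 1)) * y ^ n := fun n y => by
    rw [← hdesc, show n + (m + 1) = n + 1 + m by omega, Nat.add_sub_cancel]
    push_cast
    ring
  have hu : Summable fun n : ℕ =>
      |((n + m).descFactorial m : ℝ) * c (n + m) * (n * r ^ (n - 1))| := by
    rw [← summable_nat_add_iff 1]
    simp_rw [hterm]
    exact (summable_descFactorial_mul hc (m + 1) (by rwa [abs_of_pos hrpos])).abs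
  have h := hasDerivAt_tsum_of_isPreconnected (t := Metric.ball (0 : ℝ) r) (y₀ := 0) (y := x)
    (g := fun (n : ℕ) y => ((n + m).descFactorial m : ℝ) * c (n + m) * y ^ n)
    (g' := fun (n : ℕ) y => ((n + m).descFactorial m : ℝ) * c (n + m) * (n * y ^ (n - 1)))
    hu Metric.isOpen_ball (convex_ball _ _).isPreconnected
    (fun n y _ => (hasDerivAt_pow n y).const_mul _)
    (fun n y hy => by
      have hy' : |y| ≤ r := by simpa using (Metric.mem_ball.mp hy).le
      rw [Real.norm_eq_abs, abs_mul, abs_mul _ ((n : ℝ) * r ^ (n - 1)), abs_mul (n : ℝ),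
        abs_mul (n : ℝ), abs_pow, abs_pow, abs_of_pos hrpos]
      gcongr)
    (by simpa using hrpos) (summable_descFactorial_mul hc m (by simp)) (by simpa using hr0)
  rw [Summable.tsum_eq_zero_add] at h
  · simp_rw [hterm] at h
    simpa using h
  · rw [← summable_nat_add_iff 1]
    simp_rw [hterm]
    exact summable_descFactorial_mul hc (m + 1) hx

lemma iteratedDeriv_eq_tsum (hc : ∀ n, |c n| ≤ 1) {f : ℝ → ℝ}
    (hf : ∀ x, |x| < 1 → HasSum (fun n => c n * x ^ n) (f x)) (m : ℕ) :
    ∀ x, |x| < 1 → iteratedDeriv m f x =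
      ∑' n : ℕ, ((n + m).descFactorial m : ℝ) * c (n + m) * x ^ n := by
  induction m with
  | zero =>
    intro x hx
    simpa using (hf x hx).tsum_eq.symm
  | succ m ih =>
    intro x hx
    rw [iteratedDeriv_succ]
    have he : iteratedDeriv m f =ᶠ[𝓝 x]
        fun y => ∑' n : ℕ, ((n + m).descFactorial m : ℝ) * c (n + m) * y ^ n := by
      filter_upwards [continuous_abs.continuousAt.eventually_lt_const hx] with y hy
      exact ih y hy
    rw [he.deriv_eq]
    exact (hasDerivAt_tsum_descFactorial hc m hx).deriv

end PowerSeries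

/-! ### The series at non-negative integers -/

lemma baileyCoeff_eq (n : ℕ) :
    baileyCoeff n = ((n.factorial * wallisCoeff n ^ 2 * (1 / 2) ^ n : ℝ) : ℂ) := by
  induction n with
  | zero => simp [baileyCoeff, wallisCoeff]
  | succ n ih =>
    have h1 : (n : ℂ) + 1 ≠ 0 := Nat.cast_add_one_ne_zero n
    have h2 : 2 * (n : ℂ) + 2 ≠ 0 := fun h => h1 (by linear_combination h / 2)
    rw [baileyCoeff, Finset.prod_range_succ, ← baileyCoeff, ih, wallisCoeff, wallisCoeff,
      Finset.prod_range_succ, Nat.factorial_succ]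
    push_cast
    generalize ∏ i ∈ Finset.range n, (2 * (i : ℂ) + 1) / (2 * i + 2) = w
    rw [show 2 * (n : ℂ) + 2 = 2 * (n + 1) by ring]
    field_simp
    ring

/-- At `q = 1` and `s = m` the series is the Taylor series of `F` at `0` differentiated `m` times
termwise and evaluated at `1/2`; its terms with `n < m` vanish. -/
lemma hasSum_qSumTerm_one_natCast (m : ℕ) : HasSum (qSumTerm 1 (m : ℂ))
    ((iteratedDeriv m ellipticF (1 / 2) / ((Nat.factorial m : ℝ) * 2 ^ m) : ℝ) : ℂ) := by
  have hc : ∀ n, |wallisCoeff n ^ 2| ≤ 1 := fun n => by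
    rw [abs_of_nonneg (by positivity)]
    exact pow_le_one₀ (wallisCoeff_nonneg n) (wallisCoeff_le_one n)
  have hhalf : |(1 / 2 : ℝ)| < 1 := by rw [abs_of_pos] <;> norm_num
  have h := (summable_descFactorial_mul hc m hhalf).hasSum
  rw [← iteratedDeriv_eq_tsum hc (fun x hx => hasSum_ellipticF hx) m _ hhalf] at h
  have h2 := Complex.hasSum_ofReal.mpr (h.div_const ((Nat.factorial m : ℝ) * 2 ^ m))
  have h0 : ∑ n ∈ Finset.range m, qSumTerm 1 (m : ℂ) n = 0 := by
    refine Finset.sum_eq_zero fun n hn => ?_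
    have hn := Finset.mem_range.mp hn
    have : (1 : ℂ) - m + n = -((m - n - 1 : ℕ) : ℂ) := by
      rw [Nat.sub_sub, Nat.cast_sub (by omega)]
      push_cast
      ring
    rw [qSumTerm_one, baileyTerm, this, Complex.Gamma_neg_nat_eq_zero, inv_zero, mul_zero, mul_zero]
  rw [← add_zero (Complex.ofReal _), ← h0, ← hasSum_nat_add_iff m]
  refine h2.congr_fun fun n => ?_
  have hmn : (m.factorial : ℂ) ≠ 0 := by exact_mod_cast m.factorial_ne_zero
  have hnn : (n.factorial : ℂ) ≠ 0 := by exact_mod_cast n.factorial_ne_zero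
  have hd : ((n + m).factorial : ℂ) = n.factorial * (n + m).descFactorial m := by
    rw [← Nat.factorial_mul_descFactorial (Nat.le_add_left m n), Nat.add_sub_cancel]
    push_cast
    rfl
  rw [qSumTerm_one, baileyTerm, baileyCoeff_eq,
    show (1 : ℂ) - m + (n + m : ℕ) = n + 1 by push_cast; ring, Complex.Gamma_nat_eq_factorial,
    Complex.Gamma_nat_eq_factorial]
  push_cast
  rw [hd, pow_add, one_div_pow (2 : ℂ) m]
  field_simp

/-! ### The summation theorem -/

theorem mainTheorem5 :
    (∀ q : ℝ, 0 < q → q ≤ 1 → ∀ s : ℂ,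
      HasSum (qSumTerm q s) (qProdSide q s) ∧
      -- off the points where the last expression has the form `0 · ∞`
      ((∀ m : ℕ, qBracket q (2 * s + 2 * m + 1) ≠ 0) → qProdSide q s = qGammaSide q s) ∧
      -- and at those points by continuous extension
      Tendsto (qGammaSide q) (𝓝[≠] s) (𝓝 (qProdSide q s))) ∧
    -- the infinite product converges for `q < 1`
    (∀ q : ℝ, 0 < q → q < 1 → ∀ s : ℂ, Multipliable (qProdFactor q s)) ∧
    -- the product side has a limit as `q → 1⁻`, which is a product with regrouped factors
    (∀ s : ℂ, Tendsto (fun q : ℝ => qProdSide q s) (𝓝[<] (1 : ℝ)) (𝓝 (qProdSide 1 s)) ∧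
      HasProd (fun n : ℕ => ((4 * n + 3 - 2 * s) ^ 2 * (4 * n + 2 + 2 * s) * (4 * n + 4 + 2 * s)) /
        ((4 * (n : ℂ) + 2) ^ 2 * (4 * (n : ℂ) + 4) ^ 2)) (qProdSide 1 s)) ∧
    (Tendsto qConstTwo (𝓝[<] (1 : ℝ)) (𝓝 (1 / Real.sqrt (2 * Real.pi))) ∧
      qConstTwo 1 = 1 / Real.sqrt (2 * Real.pi)) ∧
    (∀ s : ℂ, onePlusSinPi 1 s = 1 + Complex.sin (Real.pi * s)) ∧
    -- for `q = 1` and `s = m` the series is `F⁽ᵐ⁾(1/2) / (m! 2ᵐ)`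
    (∀ m : ℕ, HasSum (qSumTerm 1 (m : ℂ))
      ((iteratedDeriv m ellipticF (1 / 2) / ((Nat.factorial m : ℝ) * 2 ^ m) : ℝ) : ℂ)) := by

  have hA : ∀ q : ℝ, 0 < q → q ≤ 1 → ∀ s : ℂ,
      (∀ m : ℕ, qBracket q (2 * s + 2 * m + 1) ≠ 0) → qProdSide q s = qGammaSide q s := by
    intro q h0 h1 s hs
    rcases h1.eq_or_lt with rfl | h1
    · rw [qProdSide_one]
      exact qProdOne_eq_qGammaSide qConstTwo_one hs
    · exact qProdSide_eq_qGammaSide_of_lt_one h0 h1 hs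
  have hcont : ∀ q : ℝ, 0 < q → q ≤ 1 → Continuous (qProdSide q) := by
    intro q h0 h1
    rcases h1.eq_or_lt with rfl | h1
    · rw [funext qProdSide_one]
      exact continuous_qProdOne
    · exact continuous_qProdSide_of_lt_one h0 h1
  refine ⟨fun q h0 h1 s => ⟨?_, hA q h0 h1 s, ?_⟩, fun q h0 h1 s =>
    (hasProd_qProdFactor h0 h1 s).multipliable, fun s => ⟨tendsto_qProdSide s, ?_⟩,
    ⟨tendsto_qConstTwo, qConstTwo_one⟩, onePlusSinPi_one, hasSum_qSumTerm_one_natCast⟩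
  · rcases h1.eq_or_lt with rfl | h1
    · rw [qProdSide_one]
      exact hasSum_qSumTerm_one s
    · exact hasSum_qSumTerm_of_lt_one h0 h1 s
  · refine (((hcont q h0 h1).tendsto s).mono_left nhdsWithin_le_nhds).congr' ?_
    filter_upwards [eventually_qBracket_ne_zero h0 h1 s] with z hz using hA q h0 h1 z hz
  · rw [qProdSide_one]
    exact hasProd_qProdOne s
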